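/- Notation. All matrices have complex entries, $M^*$ is the conjugate transpose, $\mathbf P_k$ (resp. $\overline{\mathbf P}_k$) is the set of $k\times k$ Hermitian positive definite (resp. positive semidefinite) matrices, and $\mathbb C_R=\{s\in\mathbb C:\operatorname{Re}s>0\}$. Fix $\eta\in(1,\infty]$; at $\eta=\infty$ the numbers $\frac{\eta+1}{\eta-1}$ and $\frac{1+\eta}{1-\eta}$ are read as their limits $1$ and $-1$. An $m\times m$-valued rational function $G$ belongs to $\mathcal{HB}_\eta$ if it is analytic on $\mathbb C_R$ and $$I_m-\tfrac{\eta+1}{\eta-1}\,G(s)^*G(s)\in\overline{\mathbf P}_m\qquad\text{for all } s\in\mathbb C_R .$$ The class $\mathcal{HP}_\eta$ is the image of $\mathcal{HB}_\eta$ under the Cayley transform, that is, the set of all rational functions $F=(I_m-G)(I_m+G)^{-1}$ with $G\in\mathcal{HB}_\eta$ such that $I_m+G$ is invertible as a matrix of rational functions. A realization of $F$ of dimension $n$ is a quadruple $(A,B,C,D)$ with $A\in\mathbb C^{n\times n}$, $B\in\mathbb C^{n\times m}$, $C\in\mathbb C^{m\times n}$, $D\in\mathbb C^{m\times m}$ and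 $F(s)=C(sI_n-A)^{-1}B+D$; the McMillan degree of a rational $F$ with no pole at infinity is the least dimension of a realization of $F$, and a realization of that dimension is called minimal. Theorem. Let $\eta\in(1,\infty]$, and let $F$ be an $m\times m$-valued rational function with no pole at infinity, of McMillan degree $n$, with minimal realization $(A,B,C,D)$. Then $F\in\mathcal{HP}_\eta$ if and only if $I_m+D$ is invertible and there exists $H\in\mathbf P_n$ such that $$ M^*\,W\,M\in\overline{\mathbf P}_{n+m}, $$ where $$ M=\begin{pmatrix} A-B(I_m+D)^{-1}C & -\sqrt2\,B(I_m+D)^{-1}\\ \sqrt2\,(I_m+D)^{-1}C & (I_m+D)^{-1}(I_m-D)\\ I_n & 0\\ 0 & I_m \end{pmatrix},\qquad W=\begin{pmatrix} 0&0&-H&0\\ 0&\frac{1+\eta}{1-\eta}I_m&0&0\\ -H&0&0&0\\ 0&0&0&I_m \end{pmatrix}. $$ -/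

import Mathlib

open scoped ComplexOrder ENNReal

noncomputable section

namespace HyperPositive

/-- `m × m` matrices of (complex) rational functions in one variable. -/
abbrev RatMatrix (m : ℕ) : Type := Matrix (Fin m) (Fin m) (RatFunc ℂ)

/-- `F` has no pole at the point `s` of the complex plane. -/
def NoPoleAt {m : ℕ} (F : RatMatrix m) (s : ℂ) : Prop :=
  ∀ i j, (F i j).denom.eval s ≠ 0

/-- `F` has no pole at infinity: in every entry the degree of the numerator is at most that of
the denominator. -/
def NoPoleAtInfinity {m : ℕ} (F : RatMatrix m) : Prop :=
  ∀ i j, (F i j).num.natDegree ≤ (F i j).denom.natDegree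

/-- The value `F(s)`; it is meaningful where `F` has no pole. -/
def evalAt {m : ℕ} (F : RatMatrix m) (s : ℂ) : Matrix (Fin m) (Fin m) ℂ :=
  fun i j => (F i j).eval (RingHom.id ℂ) s

/-- A matrix of complex constants, seen as a matrix of rational functions. -/
def constMatrix {k l : ℕ} (M : Matrix (Fin k) (Fin l) ℂ) : Matrix (Fin k) (Fin l) (RatFunc ℂ) :=
  M.map RatFunc.C

/-- The transfer function `C (s I - A)⁻¹ B + D`. The matrix `s I - A` is always invertible over the
field of rational functions, since its determinant is the characteristic polynomial of `A`. -/
def transferFunction {n m : ℕ} (A : Matrix (Fin n) (Fin n) ℂ) (B : Matrix (Fin n) (Fin m) ℂ)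
    (C : Matrix (Fin m) (Fin n) ℂ) (D : Matrix (Fin m) (Fin m) ℂ) : RatMatrix m :=
  constMatrix C * (Matrix.scalar (Fin n) RatFunc.X - constMatrix A)⁻¹ * constMatrix B
    + constMatrix D

/-- `F` has a state space realization with an `n`-dimensional state space. -/
def HasRealizationOfDim {m : ℕ} (F : RatMatrix m) (n : ℕ) : Prop :=
  ∃ (A : Matrix (Fin n) (Fin n) ℂ) (B : Matrix (Fin n) (Fin m) ℂ)
    (C : Matrix (Fin m) (Fin n) ℂ) (D : Matrix (Fin m) (Fin m) ℂ),
    F = transferFunction A B C D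

/-- The McMillan degree of a rational matrix without pole at infinity: the least dimension of the
state space of a realization. -/
def mcMillanDegree {m : ℕ} (F : RatMatrix m) : ℕ :=
  sInf {n : ℕ | HasRealizationOfDim F n}

/-- `(A, B, C, D)` is a minimal realization of `F`: a realization whose state space has the
McMillan degree of `F` as its dimension. -/
structure IsMinimalRealization {n m : ℕ} (F : RatMatrix m)
    (A : Matrix (Fin n) (Fin n) ℂ) (B : Matrix (Fin n) (Fin m) ℂ)
    (C : Matrix (Fin m) (Fin n) ℂ) (D : Matrix (Fin m) (Fin m) ℂ) : Prop where
  realizes : F = transferFunction A B C D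
  minimal : n = mcMillanDegree F

/-- The Cayley transform `(I - M) (I + M)⁻¹`; it is defined when `I + M` is invertible. -/
def cayley {m : ℕ} {R : Type*} [CommRing R] (M : Matrix (Fin m) (Fin m) R) :
    Matrix (Fin m) (Fin m) R :=
  (1 - M) * (1 + M)⁻¹

/-- The number `(η + 1) / (η - 1)` for `η ∈ (1, ∞]`, with the limit value `1` at `η = ∞`. -/
def boundedRatio (η : ℝ≥0∞) : ℝ :=
  if η = ⊤ then 1 else (η.toReal + 1) / (η.toReal - 1)

/-- The number `(1 + η) / (1 - η)` for `η ∈ (1, ∞]`, with the limit value `-1` at `η = ∞`. -/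
def weightRatio (η : ℝ≥0∞) : ℝ :=
  if η = ⊤ then -1 else (1 + η.toReal) / (1 - η.toReal)

/-- The class `HB_η` of `η`-hyper-bounded functions: analytic on the open right half-plane, with
`I - ((η + 1) / (η - 1)) G(s)* G(s)` positive semidefinite there. -/
def HB (m : ℕ) (η : ℝ≥0∞) : Set (RatMatrix m) :=
  {G | ∀ s : ℂ, 0 < s.re → NoPoleAt G s ∧
    (1 - ((boundedRatio η : ℝ) : ℂ) • ((evalAt G s).conjTranspose * evalAt G s)).PosSemidef}

/-- The class `HP_η` of `η`-hyper-positive functions: the image of `HB_η` under the Cayley transform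
(taken of those members where it is defined). -/
def HP (m : ℕ) (η : ℝ≥0∞) : Set (RatMatrix m) :=
  {F | ∃ G ∈ HB m η, IsUnit (1 + G) ∧ F = cayley G}

/-- The state space array of the Cayley transform of the function realized by `(A, B, C, D)`,
stacked on the identity of size `n + m`. -/
def stackedCayley {n m : ℕ} (A : Matrix (Fin n) (Fin n) ℂ) (B : Matrix (Fin n) (Fin m) ℂ)
    (C : Matrix (Fin m) (Fin n) ℂ) (D : Matrix (Fin m) (Fin m) ℂ) :
    Matrix ((Fin n ⊕ Fin m) ⊕ (Fin n ⊕ Fin m)) (Fin n ⊕ Fin m) ℂ :=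
  Matrix.fromRows
    (Matrix.fromBlocks
      (A - B * (1 + D)⁻¹ * C) (-(((√2 : ℝ) : ℂ) • (B * (1 + D)⁻¹)))
      (((√2 : ℝ) : ℂ) • ((1 + D)⁻¹ * C)) ((1 + D)⁻¹ * (1 - D)))
    (Matrix.fromBlocks 1 0 0 1)

/-- The indefinite weight
`W = [[0, 0, -H, 0], [0, ((1 + η) / (1 - η)) I, 0, 0], [-H, 0, 0, 0], [0, 0, 0, I]]`. -/
def weight {n : ℕ} (m : ℕ) (η : ℝ≥0∞) (H : Matrix (Fin n) (Fin n) ℂ) :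
    Matrix ((Fin n ⊕ Fin m) ⊕ (Fin n ⊕ Fin m)) ((Fin n ⊕ Fin m) ⊕ (Fin n ⊕ Fin m)) ℂ :=
  Matrix.fromBlocks
    (Matrix.fromBlocks 0 0 0 (((weightRatio η : ℝ) : ℂ) • 1)) (Matrix.fromBlocks (-H) 0 0 0)
    (Matrix.fromBlocks (-H) 0 0 0) (Matrix.fromBlocks 0 0 0 1)

end HyperPositive

end

/-!
The statement is a bounded real lemma. Write `J = (1 + D)⁻¹`. The four blocks of the stacked array
are a realization `(Â, B̂, Ĉ, D̂)` of the Cayley transform `G` of `F`, because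
`(1 + F) (1 + G) = 2` (`one_add_transferFunction_mul`), and the matrix inequality says that
`x ↦ x* H x` is a storage function for it: with `c = (η + 1) / (η - 1)`,
`2 Re ⟪x, H (Â x + B̂ u)⟫ + c ‖Ĉ x + D̂ u‖² ≤ ‖u‖²` for all `x` and `u` (`posSemidef_weight_iff`).

From a storage function to the class `HB_η`, insert `s x = Â x + B̂ u` with `Re s > 0`: for `u = 0`
this excludes eigenvalues of `Â` in the right half-plane, and in general it gives
`c ‖G(s) u‖² ≤ ‖u‖²` (`transferFunction_mem_HB`).

Conversely, let `F` be the Cayley transform of `G` in `HB_η`. Boundedness of `G` near infinity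
forces `1 + D` to be invertible (`isUnit_one_add_of_mul_eq_two`), so that `G` has the realization
above; it is controllable and observable because the realization of `F` is minimal. The storage
function is found in discrete time. The substitution `s = a (1 - z) / (1 + z)`, for some `a > 0`
that is not an eigenvalue of `Â`, turns `G` into a function on the unit disk with a discrete-time
realization that is again controllable and observable, and storage functions correspond up to the
factor `2 a` (`exists_continuous_storage`). In discrete time, comparing mean squares on circles
`‖z‖ = r` and letting `r → 1` shows that the supplied energy `∑ ‖u‖² - c ‖y‖²` is nonnegative on
finitely supported inputs (`output_le`). It is thus a positive semidefinite form, and its infimum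
over the inputs that steer the system from rest to `x` is a quadratic form `x* H x`
(`exists_posSemidef_fiberInf`). Continuing an input by one step gives the dissipation inequality,
and observability makes `H` definite (`exists_discrete_storage`).
-/

open scoped ComplexOrder ENNReal

namespace HyperPositive

/-! ### Values of rational matrices -/

/-- The rational function `f` is regular at `s` and takes the value `v` there. -/
def HasValueAt (f : RatFunc ℂ) (s v : ℂ) : Prop :=
  f.denom.eval s ≠ 0 ∧ f.eval (RingHom.id ℂ) s = v

theorem HasValueAt.add {f g : RatFunc ℂ} {s v w : ℂ} (hf : HasValueAt f s v)
    (hg : HasValueAt g s w) : HasValueAt (f + g) s (v + w) := by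
  refine ⟨fun h => ?_, ?_⟩
  · have := Polynomial.eval_eq_zero_of_dvd_of_eval_eq_zero (RatFunc.denom_add_dvd f g) h
    rw [Polynomial.eval_mul] at this
    exact (mul_ne_zero hf.1 hg.1) this
  · rw [RatFunc.eval_add _ _ hf.1 hg.1, hf.2, hg.2]

theorem HasValueAt.mul {f g : RatFunc ℂ} {s v w : ℂ} (hf : HasValueAt f s v)
    (hg : HasValueAt g s w) : HasValueAt (f * g) s (v * w) := by
  refine ⟨fun h => ?_, ?_⟩
  · have := Polynomial.eval_eq_zero_of_dvd_of_eval_eq_zero (RatFunc.denom_mul_dvd f g) h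
    rw [Polynomial.eval_mul] at this
    exact (mul_ne_zero hf.1 hg.1) this
  · rw [RatFunc.eval_mul _ _ hf.1 hg.1, hf.2, hg.2]

theorem hasValueAt_C (a s : ℂ) : HasValueAt (RatFunc.C a) s a :=
  ⟨by simp, by simp⟩

theorem HasValueAt.sum {ι : Type*} (t : Finset ι) {f : ι → RatFunc ℂ} {s : ℂ} {v : ι → ℂ}
    (h : ∀ i ∈ t, HasValueAt (f i) s (v i)) : HasValueAt (∑ i ∈ t, f i) s (∑ i ∈ t, v i) := by
  classical
  induction t using Finset.induction_on with
  | empty => simpa using hasValueAt_C 0 s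
  | insert a t ha ih =>
    rw [Finset.sum_insert ha, Finset.sum_insert ha]
    exact (h a (by simp)).add (ih fun i hi => h i (by simp [hi]))

theorem hasValueAt_div (p q : Polynomial ℂ) {s : ℂ} (hq : q.eval s ≠ 0) :
    HasValueAt (algebraMap _ (RatFunc ℂ) p / algebraMap _ (RatFunc ℂ) q) s
      (p.eval s / q.eval s) := by
  have hden : (algebraMap _ (RatFunc ℂ) p / algebraMap _ (RatFunc ℂ) q).denom.eval s ≠ 0 :=
    fun h => hq (Polynomial.eval_eq_zero_of_dvd_of_eval_eq_zero (RatFunc.denom_div_dvd p q) h)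
  have hq0 : q ≠ 0 := by rintro rfl; simp at hq
  refine ⟨hden, ?_⟩
  rw [eq_div_iff hq]
  have h := RatFunc.eval_mul (f := RingHom.id ℂ) (a := s) hden
    (y := algebraMap _ (RatFunc ℂ) q) (by simp)
  rw [div_mul_cancel₀ _ (RatFunc.algebraMap_ne_zero hq0)] at h
  simpa using h.symm

/-- The rational matrix `F` has no pole at `s`, and `F(s) = V`. -/
def MatrixHasValueAt {m : ℕ} (F : RatMatrix m) (s : ℂ) (V : Matrix (Fin m) (Fin m) ℂ) : Prop :=
  ∀ i j, HasValueAt (F i j) s (V i j)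

theorem matrixHasValueAt_iff {m : ℕ} {F : RatMatrix m} {s : ℂ} {V : Matrix (Fin m) (Fin m) ℂ} :
    MatrixHasValueAt F s V ↔ NoPoleAt F s ∧ evalAt F s = V := by
  constructor
  · exact fun h => ⟨fun i j => (h i j).1, Matrix.ext fun i j => (h i j).2⟩
  · rintro ⟨h, rfl⟩ i j
    exact ⟨h i j, rfl⟩

theorem NoPoleAt.matrixHasValueAt {m : ℕ} {F : RatMatrix m} {s : ℂ} (h : NoPoleAt F s) :
    MatrixHasValueAt F s (evalAt F s) := matrixHasValueAt_iff.2 ⟨h, rfl⟩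

theorem MatrixHasValueAt.unique {m : ℕ} {F : RatMatrix m} {s : ℂ} {V W : Matrix (Fin m) (Fin m) ℂ}
    (hV : MatrixHasValueAt F s V) (hW : MatrixHasValueAt F s W) : V = W :=
  (matrixHasValueAt_iff.1 hV).2.symm.trans (matrixHasValueAt_iff.1 hW).2

theorem MatrixHasValueAt.add {m : ℕ} {F G : RatMatrix m} {s : ℂ} {V W : Matrix (Fin m) (Fin m) ℂ}
    (hF : MatrixHasValueAt F s V) (hG : MatrixHasValueAt G s W) :
    MatrixHasValueAt (F + G) s (V + W) := fun i j => (hF i j).add (hG i j)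

theorem MatrixHasValueAt.mul {m : ℕ} {F G : RatMatrix m} {s : ℂ} {V W : Matrix (Fin m) (Fin m) ℂ}
    (hF : MatrixHasValueAt F s V) (hG : MatrixHasValueAt G s W) :
    MatrixHasValueAt (F * G) s (V * W) := fun i j => by
  simpa only [Matrix.mul_apply] using
    HasValueAt.sum Finset.univ fun k _ => (hF i k).mul (hG k j)

theorem matrixHasValueAt_constMatrix {m : ℕ} (V : Matrix (Fin m) (Fin m) ℂ) (s : ℂ) :
    MatrixHasValueAt (constMatrix V) s V := fun i j => hasValueAt_C (V i j) s

theorem constMatrix_mul {k l p : ℕ} (M : Matrix (Fin k) (Fin l) ℂ) (N : Matrix (Fin l) (Fin p) ℂ) :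
    constMatrix (M * N) = constMatrix M * constMatrix N :=
  Matrix.map_mul

theorem constMatrix_add {k l : ℕ} (M N : Matrix (Fin k) (Fin l) ℂ) :
    constMatrix (M + N) = constMatrix M + constMatrix N :=
  Matrix.map_add _ (map_add _) _ _

theorem constMatrix_sub {k l : ℕ} (M N : Matrix (Fin k) (Fin l) ℂ) :
    constMatrix (M - N) = constMatrix M - constMatrix N :=
  Matrix.map_sub _ (map_sub _) _ _

theorem constMatrix_one {k : ℕ} : constMatrix (1 : Matrix (Fin k) (Fin k) ℂ) = 1 :=
  Matrix.map_one _ (map_zero _) (map_one _)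

theorem constMatrix_neg {k l : ℕ} (M : Matrix (Fin k) (Fin l) ℂ) :
    constMatrix (-M) = -constMatrix M := by
  ext i j; simp [constMatrix]

theorem constMatrix_smul {k l : ℕ} (a : ℂ) (M : Matrix (Fin k) (Fin l) ℂ) :
    constMatrix (a • M) = RatFunc.C a • constMatrix M := by
  ext i j; simp [constMatrix]

theorem scalar_sub_constMatrix {n : ℕ} (A : Matrix (Fin n) (Fin n) ℂ) :
    Matrix.scalar (Fin n) RatFunc.X - constMatrix A =
      A.charmatrix.map (algebraMap (Polynomial ℂ) (RatFunc ℂ)) := by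
  ext i j
  by_cases h : i = j <;> simp [constMatrix, h, RatFunc.algebraMap_C]

theorem det_scalar_sub_constMatrix {n : ℕ} (A : Matrix (Fin n) (Fin n) ℂ) :
    (Matrix.scalar (Fin n) RatFunc.X - constMatrix A).det =
      algebraMap (Polynomial ℂ) (RatFunc ℂ) A.charpoly := by
  rw [scalar_sub_constMatrix, Matrix.charpoly]
  exact (RingHom.map_det _ _).symm

theorem isUnit_det_scalar_sub_constMatrix {n : ℕ} (A : Matrix (Fin n) (Fin n) ℂ) :
    IsUnit (Matrix.scalar (Fin n) RatFunc.X - constMatrix A).det := by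
  rw [det_scalar_sub_constMatrix, isUnit_iff_ne_zero]
  exact RatFunc.algebraMap_ne_zero A.charpoly_monic.ne_zero

theorem transferFunction_hasValueAt {n m : ℕ} (A : Matrix (Fin n) (Fin n) ℂ)
    (B : Matrix (Fin n) (Fin m) ℂ) (C : Matrix (Fin m) (Fin n) ℂ) (D : Matrix (Fin m) (Fin m) ℂ)
    {s : ℂ} (hs : (Matrix.scalar (Fin n) s - A).det ≠ 0) :
    MatrixHasValueAt (transferFunction A B C D) s
      (C * (Matrix.scalar (Fin n) s - A)⁻¹ * B + D) := by
  have hev : A.charpoly.eval s = (Matrix.scalar (Fin n) s - A).det := Matrix.eval_charpoly A s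
  refine MatrixHasValueAt.add (fun i j => ?_) (matrixHasValueAt_constMatrix D s)
  set P : Matrix (Fin m) (Fin m) (Polynomial ℂ) :=
    C.map Polynomial.C * A.charmatrix.adjugate * B.map Polynomial.C with hP
  have h1 : (constMatrix C * (Matrix.scalar (Fin n) RatFunc.X - constMatrix A)⁻¹ * constMatrix B)
      = (algebraMap (Polynomial ℂ) (RatFunc ℂ) A.charpoly)⁻¹ •
        P.map (algebraMap (Polynomial ℂ) (RatFunc ℂ)) := by
    rw [Matrix.inv_def, det_scalar_sub_constMatrix, Ring.inverse_eq_inv', hP, Matrix.map_mul,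
      Matrix.map_mul, Matrix.mul_smul, Matrix.smul_mul, scalar_sub_constMatrix,
      ← RingHom.mapMatrix_apply _ A.charmatrix, ← RingHom.map_adjugate]
    congr 3
  have h2 : (C * (Matrix.scalar (Fin n) s - A)⁻¹ * B) = (A.charpoly.eval s)⁻¹ •
      P.map (Polynomial.evalRingHom s) := by
    have h3 : A.charmatrix.map (Polynomial.evalRingHom s) = Matrix.scalar (Fin n) s - A := by
      ext i j
      by_cases h : i = j <;> simp [h]
    rw [Matrix.inv_def, ← hev, Ring.inverse_eq_inv', hP, Matrix.map_mul,
      Matrix.map_mul, Matrix.mul_smul, Matrix.smul_mul, ← h3,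
      ← RingHom.mapMatrix_apply _ A.charmatrix, ← RingHom.map_adjugate]
    congr 3 <;> (ext i j; simp)
  rw [h1, h2]
  have := hasValueAt_div (P i j) A.charpoly (hev ▸ hs)
  simpa [div_eq_inv_mul] using this

/-! ### Minimal realizations are controllable and observable -/

/-- If `P` intertwines two systems, they have the same transfer function. -/
theorem transferFunction_eq_of_intertwine {n k m : ℕ} {A₁ : Matrix (Fin n) (Fin n) ℂ}
    {B₁ : Matrix (Fin n) (Fin m) ℂ} {C₁ : Matrix (Fin m) (Fin n) ℂ}
    {A₂ : Matrix (Fin k) (Fin k) ℂ} {B₂ : Matrix (Fin k) (Fin m) ℂ}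
    {C₂ : Matrix (Fin m) (Fin k) ℂ} (D : Matrix (Fin m) (Fin m) ℂ) (P : Matrix (Fin n) (Fin k) ℂ)
    (hA : A₁ * P = P * A₂) (hB : B₁ = P * B₂) (hC : C₂ = C₁ * P) :
    transferFunction A₁ B₁ C₁ D = transferFunction A₂ B₂ C₂ D := by
  have h1 := isUnit_det_scalar_sub_constMatrix A₁
  have h2 := isUnit_det_scalar_sub_constMatrix A₂
  unfold transferFunction
  set S₁ := Matrix.scalar (Fin n) (RatFunc.X (K := ℂ)) - constMatrix A₁ with hS₁
  set S₂ := Matrix.scalar (Fin k) (RatFunc.X (K := ℂ)) - constMatrix A₂ with hS₂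
  have hS : S₁ * constMatrix P = constMatrix P * S₂ := by
    rw [hS₁, hS₂, Matrix.sub_mul, Matrix.mul_sub, ← constMatrix_mul, ← constMatrix_mul, hA]
    congr 1
    ext i j
    simp [Matrix.scalar_apply, mul_comm]
  have hS' : S₁⁻¹ * constMatrix P = constMatrix P * S₂⁻¹ := by
    rw [← Matrix.mul_nonsing_inv_cancel_right S₂ (S₁⁻¹ * constMatrix P) h2, Matrix.mul_assoc S₁⁻¹,
      ← hS, Matrix.nonsing_inv_mul_cancel_left S₁ _ h1]
  rw [hB, hC, constMatrix_mul, constMatrix_mul]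
  congr 1
  simp only [Matrix.mul_assoc]
  rw [← Matrix.mul_assoc S₁⁻¹, hS']
  simp only [Matrix.mul_assoc]

/-- The pair `(A, B)` is controllable, in the form: an `A`-invariant subspace that contains the
range of `B` is the whole state space. -/
def Controllable {n m : ℕ} (A : Matrix (Fin n) (Fin n) ℂ) (B : Matrix (Fin n) (Fin m) ℂ) : Prop :=
  ∀ W : Submodule ℂ (Fin n → ℂ), (∀ u, B.mulVec u ∈ W) → (∀ x ∈ W, A.mulVec x ∈ W) → W = ⊤

/-- The pair `(C, A)` is observable, in the form: an `A`-invariant subspace of the kernel of `C`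
is trivial. -/
def Observable {n m : ℕ} (A : Matrix (Fin n) (Fin n) ℂ) (C : Matrix (Fin m) (Fin n) ℂ) : Prop :=
  ∀ W : Submodule ℂ (Fin n → ℂ), (∀ x ∈ W, C.mulVec x = 0) → (∀ x ∈ W, A.mulVec x ∈ W) → W = ⊥

theorem IsMinimalRealization.le_of_hasRealizationOfDim {n m : ℕ} {F : RatMatrix m}
    {A : Matrix (Fin n) (Fin n) ℂ} {B : Matrix (Fin n) (Fin m) ℂ} {C : Matrix (Fin m) (Fin n) ℂ}
    {D : Matrix (Fin m) (Fin m) ℂ} (h : IsMinimalRealization F A B C D) {k : ℕ}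
    (hk : HasRealizationOfDim F k) : n ≤ k :=
  h.minimal.trans_le (Nat.sInf_le hk)

/-- A basis of an invariant subspace containing the range of `B` gives a smaller realization. -/
theorem IsMinimalRealization.controllable {n m : ℕ} {F : RatMatrix m}
    {A : Matrix (Fin n) (Fin n) ℂ} {B : Matrix (Fin n) (Fin m) ℂ} {C : Matrix (Fin m) (Fin n) ℂ}
    {D : Matrix (Fin m) (Fin m) ℂ} (h : IsMinimalRealization F A B C D) : Controllable A B := by
  intro W hB hA
  set k := Module.finrank ℂ W
  let b : (Fin k → ℂ) ≃ₗ[ℂ] W := (Module.finBasis ℂ W).equivFun.symm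
  obtain ⟨p, hp⟩ := W.exists_isCompl
  let π : (Fin n → ℂ) →ₗ[ℂ] W := W.projectionOnto p hp
  have hπ : ∀ x : W, π x = x := fun x => Submodule.projectionOnto_apply_left hp x
  let P : Matrix (Fin n) (Fin k) ℂ := LinearMap.toMatrix' (W.subtype ∘ₗ b.toLinearMap)
  let Q : Matrix (Fin k) (Fin n) ℂ := LinearMap.toMatrix' (b.symm.toLinearMap ∘ₗ π)
  have hPQ : ∀ x ∈ W, P.mulVec (Q.mulVec x) = x := by
    intro x hx
    simp [P, Q, LinearMap.toMatrix'_mulVec, hπ ⟨x, hx⟩]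
  have hPW : ∀ y, P.mulVec y ∈ W := by
    intro y
    simp [P, LinearMap.toMatrix'_mulVec]
  have hk : HasRealizationOfDim F k := by
    refine ⟨Q * A * P, Q * B, C * P, D, ?_⟩
    rw [h.realizes]
    refine transferFunction_eq_of_intertwine D P ?_ ?_ rfl
    · refine Matrix.ext_of_mulVec_single fun i => ?_
      simp only [← Matrix.mulVec_mulVec]
      rw [hPQ _ (hA _ (hPW _))]
    · refine Matrix.ext_of_mulVec_single fun i => ?_
      simp only [← Matrix.mulVec_mulVec]
      rw [hPQ _ (hB _)]
  have := h.le_of_hasRealizationOfDim hk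
  refine Submodule.eq_top_of_finrank_eq (le_antisymm (Submodule.finrank_le W) ?_)
  simpa using this

/-- Passing to the quotient by an invariant subspace of the kernel of `C` gives a smaller
realization. -/
theorem IsMinimalRealization.observable {n m : ℕ} {F : RatMatrix m}
    {A : Matrix (Fin n) (Fin n) ℂ} {B : Matrix (Fin n) (Fin m) ℂ} {C : Matrix (Fin m) (Fin n) ℂ}
    {D : Matrix (Fin m) (Fin m) ℂ} (h : IsMinimalRealization F A B C D) : Observable A C := by
  intro W hC hA
  obtain ⟨p, hp⟩ := W.exists_isCompl
  set k := Module.finrank ℂ p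
  let b : (Fin k → ℂ) ≃ₗ[ℂ] p := (Module.finBasis ℂ p).equivFun.symm
  let π : (Fin n → ℂ) →ₗ[ℂ] p := p.projectionOnto W hp.symm
  let P : Matrix (Fin n) (Fin k) ℂ := LinearMap.toMatrix' (p.subtype ∘ₗ b.toLinearMap)
  let Q : Matrix (Fin k) (Fin n) ℂ := LinearMap.toMatrix' (b.symm.toLinearMap ∘ₗ π)
  have hsub : ∀ x, x - P.mulVec (Q.mulVec x) ∈ W := by
    intro x
    have h1 : P.mulVec (Q.mulVec x) = π x := by simp [P, Q, LinearMap.toMatrix'_mulVec]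
    rw [h1, ← Submodule.projectionOnto_apply_eq_zero_iff hp.symm, map_sub, sub_eq_zero]
    exact (Submodule.projectionOnto_apply_left hp.symm (π x)).symm
  have hQW : ∀ x ∈ W, Q.mulVec x = 0 := by
    intro x hx
    have : π x = 0 := (Submodule.projectionOnto_apply_eq_zero_iff hp.symm).2 hx
    simp [Q, LinearMap.toMatrix'_mulVec, this]
  have hk : HasRealizationOfDim F k := by
    refine ⟨Q * A * P, Q * B, C * P, D, ?_⟩
    rw [h.realizes]
    refine (transferFunction_eq_of_intertwine D Q ?_ rfl ?_).symm
    · refine Matrix.ext_of_mulVec_single fun i => ?_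
      simp only [← Matrix.mulVec_mulVec]
      have := hQW _ (hA _ (hsub (Pi.single i 1)))
      rw [Matrix.mulVec_sub, Matrix.mulVec_sub, sub_eq_zero] at this
      exact this.symm
    · refine Matrix.ext_of_mulVec_single fun i => ?_
      simp only [← Matrix.mulVec_mulVec]
      have := hC _ (hsub (Pi.single i 1))
      rwa [Matrix.mulVec_sub, sub_eq_zero] at this
  have h1 := h.le_of_hasRealizationOfDim hk
  have h2 := Submodule.finrank_add_eq_of_isCompl hp
  rw [Module.finrank_fin_fun] at h2
  exact Submodule.finrank_eq_zero.1 (by omega)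

/-! ### The Cayley transform and the dissipation inequality -/

/-- The array of `stackedCayley` realizes the Cayley transform `G` of `F`, in the division-free form
`(1 + F) (1 + G) = 2`. It rests on the resolvent identity for `A` and `A - B (1 + D)⁻¹ C`. -/
theorem one_add_transferFunction_mul {n m : ℕ} (A : Matrix (Fin n) (Fin n) ℂ)
    (B : Matrix (Fin n) (Fin m) ℂ) (C : Matrix (Fin m) (Fin n) ℂ) (D : Matrix (Fin m) (Fin m) ℂ)
    (hD : IsUnit (1 + D)) :
    (1 + transferFunction A B C D) *
      (1 + transferFunction (A - B * (1 + D)⁻¹ * C) (-(((√2 : ℝ) : ℂ) • (B * (1 + D)⁻¹)))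
        (((√2 : ℝ) : ℂ) • ((1 + D)⁻¹ * C)) ((1 + D)⁻¹ * (1 - D))) = 2 := by
  rw [Matrix.isUnit_iff_isUnit_det] at hD
  have h1 := isUnit_det_scalar_sub_constMatrix A
  have h2 := isUnit_det_scalar_sub_constMatrix (A - B * (1 + D)⁻¹ * C)
  unfold transferFunction
  set J := (1 + D)⁻¹ with hJ
  have hJ1 : (1 + D) * J = 1 := Matrix.mul_nonsing_inv _ hD
  have hJ2 : J * (1 + D) = 1 := Matrix.nonsing_inv_mul _ hD
  set S := Matrix.scalar (Fin n) (RatFunc.X (K := ℂ)) - constMatrix A with hS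
  set S' := Matrix.scalar (Fin n) (RatFunc.X (K := ℂ)) - constMatrix (A - B * J * C) with hS'
  have hres : S⁻¹ * (constMatrix B * (constMatrix J * constMatrix C)) * S'⁻¹ = S⁻¹ - S'⁻¹ := by
    have : constMatrix B * (constMatrix J * constMatrix C) = S' - S := by
      rw [hS, hS', constMatrix_sub, constMatrix_mul, constMatrix_mul, Matrix.mul_assoc]
      abel
    rw [this, Matrix.mul_sub, Matrix.sub_mul, Matrix.nonsing_inv_mul _ h1, Matrix.one_mul,
      Matrix.mul_assoc, Matrix.mul_nonsing_inv _ h2, Matrix.mul_one]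
  have hsq : RatFunc.C ((√2 : ℝ) : ℂ) * RatFunc.C ((√2 : ℝ) : ℂ) = (2 : RatFunc ℂ) := by
    rw [← map_mul, ← Complex.ofReal_mul, Real.mul_self_sqrt (by norm_num)]
    simpa using map_ofNat (RatFunc.C (K := ℂ)) 2
  have hJ1' : (1 + constMatrix D) * constMatrix J = 1 := by
    rw [← constMatrix_one, ← constMatrix_add, ← constMatrix_mul, hJ1]
  have hfd : (1 : RatMatrix m) + constMatrix (J * (1 - D)) = (2 : RatFunc ℂ) • constMatrix J := by
    have h3 : 1 + J * (1 - D) = (2 : ℂ) • J := by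
      calc 1 + J * (1 - D) = J * (1 + D) + J * (1 - D) := by rw [hJ2]
        _ = (2 : ℂ) • J := by rw [two_smul]; noncomm_ring
    rw [← constMatrix_one, ← constMatrix_add, h3, constMatrix_smul]
    congr 1
    exact map_ofNat (RatFunc.C (K := ℂ)) 2
  set b := constMatrix B
  set c := constMatrix C
  set j := constMatrix J
  have hT : (1 : RatMatrix m) + (constMatrix (((√2 : ℝ) : ℂ) • (J * C)) * S'⁻¹ *
      constMatrix (-(((√2 : ℝ) : ℂ) • (B * J))) + constMatrix (J * (1 - D)))
      = (2 : RatFunc ℂ) • (j - j * (c * S'⁻¹ * b) * j) := by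
    rw [add_left_comm, hfd, constMatrix_neg, constMatrix_smul, constMatrix_smul, constMatrix_mul,
      constMatrix_mul, Matrix.mul_neg, Matrix.mul_smul, Matrix.smul_mul, Matrix.smul_mul, smul_smul,
      hsq, smul_sub]
    simp only [Matrix.mul_assoc]
    abel
  rw [hT, Matrix.mul_smul]
  have key : (1 + (c * S⁻¹ * b + constMatrix D)) * (j - j * (c * S'⁻¹ * b) * j) = 1 := by
    calc _ = (1 + constMatrix D) * j + c * S⁻¹ * b * j
          - ((1 + constMatrix D) * j) * (c * S'⁻¹ * b) * j
          - c * (S⁻¹ * (b * (j * c)) * S'⁻¹) * b * j := by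
            simp only [Matrix.mul_assoc, Matrix.add_mul, Matrix.mul_sub, Matrix.one_mul]
            abel
      _ = 1 := by
            rw [hres, hJ1', Matrix.mul_sub, Matrix.sub_mul, Matrix.sub_mul, Matrix.one_mul]
            abel
  rw [key]
  ext i k
  by_cases h : i = k <;> simp [h, Matrix.ofNat_apply]

theorem isUnit_det_of_mul_eq_two {m : ℕ} {U V : RatMatrix m} (h : U * V = 2) :
    IsUnit U.det ∧ IsUnit V.det := by
  have h2 : IsUnit (2 : RatMatrix m) := by
    have : (2 : RatMatrix m) = algebraMap (RatFunc ℂ) _ 2 := (map_ofNat _ 2).symm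
    rw [this]
    exact (isUnit_iff_ne_zero.2 two_ne_zero).map _
  rwa [Matrix.isUnit_iff_isUnit_det, ← h, Matrix.det_mul, IsUnit.mul_iff] at h2

theorem eq_of_one_add_mul_eq_two {m : ℕ} {F G K : RatMatrix m} (hG : (1 + F) * (1 + G) = 2)
    (hK : (1 + F) * (1 + K) = 2) : G = K := by
  have hdet := (isUnit_det_of_mul_eq_two hG).1
  have h := congrArg ((1 + F)⁻¹ * ·) (hG.trans hK.symm)
  simp only [Matrix.nonsing_inv_mul_cancel_left _ _ hdet] at h
  exact add_left_cancel h

theorem eq_cayley_of_mul_eq_two {m : ℕ} {F G : RatMatrix m} (h : (1 + F) * (1 + G) = 2) :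
    IsUnit (1 + G) ∧ F = cayley G := by
  have hdet : IsUnit (1 + G).det := (isUnit_det_of_mul_eq_two h).2
  refine ⟨(Matrix.isUnit_iff_isUnit_det _).2 hdet, ?_⟩
  unfold cayley
  have h3 : F * (1 + G) = 1 - G := by
    have : F * (1 + G) = (1 + F) * (1 + G) - (1 + G) := by noncomm_ring
    rw [this, h, ← one_add_one_eq_two]
    abel
  rw [← h3, Matrix.mul_nonsing_inv_cancel_right _ _ hdet]

theorem one_add_cayley_mul {m : ℕ} {G : RatMatrix m} (h : IsUnit (1 + G)) :
    (1 + cayley G) * (1 + G) = 2 := by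
  rw [Matrix.isUnit_iff_isUnit_det] at h
  rw [cayley, add_mul, Matrix.mul_assoc, Matrix.nonsing_inv_mul _ h, ← one_add_one_eq_two]
  noncomm_ring

/-- Squared Euclidean length of a complex vector. -/
noncomputable def sqNorm {k : ℕ} (u : Fin k → ℂ) : ℝ := ∑ i, ‖u i‖ ^ 2

theorem star_dotProduct_self {k : ℕ} (u : Fin k → ℂ) : star u ⬝ᵥ u = (sqNorm u : ℂ) := by
  simp [dotProduct, sqNorm, Complex.conj_mul']

theorem sqNorm_nonneg {k : ℕ} (u : Fin k → ℂ) : 0 ≤ sqNorm u :=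
  Finset.sum_nonneg fun _ _ => sq_nonneg _

theorem sqNorm_eq_zero {k : ℕ} {u : Fin k → ℂ} (h : sqNorm u = 0) : u = 0 := by
  rw [sqNorm, Finset.sum_eq_zero_iff_of_nonneg fun _ _ => sq_nonneg _] at h
  ext i
  simpa using h i (Finset.mem_univ i)

/-- The quadratic form `x* H x` of a matrix, as a real number. -/
noncomputable def quadForm {k : ℕ} (H : Matrix (Fin k) (Fin k) ℂ) (x : Fin k → ℂ) : ℝ :=
  (star x ⬝ᵥ H.mulVec x).re

theorem posSemidef_one_sub_iff {m : ℕ} (c : ℝ) (V : Matrix (Fin m) (Fin m) ℂ) :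
    (1 - (c : ℂ) • (V.conjTranspose * V)).PosSemidef ↔
      ∀ u, c * sqNorm (V.mulVec u) ≤ sqNorm u := by
  have hq : ∀ u, star u ⬝ᵥ (1 - (c : ℂ) • (V.conjTranspose * V)).mulVec u =
      ((sqNorm u - c * sqNorm (V.mulVec u) : ℝ) : ℂ) := by
    intro u
    rw [Matrix.sub_mulVec, Matrix.one_mulVec, Matrix.smul_mulVec, dotProduct_sub, dotProduct_smul,
      ← Matrix.mulVec_mulVec, Matrix.dotProduct_mulVec, ← Matrix.star_mulVec,
      star_dotProduct_self, star_dotProduct_self]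
    simp
  rw [Matrix.posSemidef_iff_dotProduct_mulVec]
  constructor
  · rintro ⟨-, h⟩ u
    have := h u
    rw [hq] at this
    linarith [Complex.zero_le_real.1 this]
  · intro h
    refine ⟨?_, fun u => ?_⟩
    · simp [Matrix.IsHermitian, Matrix.conjTranspose_sub, Matrix.conjTranspose_smul]
    · rw [hq]
      exact Complex.zero_le_real.2 (by linarith [h u])

theorem weightRatio_eq_neg {η : ℝ≥0∞} (hη : 1 < η) : weightRatio η = -boundedRatio η := by
  unfold weightRatio boundedRatio
  split_ifs with h
  · rfl
  · have : 1 < η.toReal := by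
      rw [← ENNReal.toReal_one]
      exact (ENNReal.toReal_lt_toReal (by simp) h).2 hη
    rw [← neg_sub η.toReal 1, div_neg, add_comm]

theorem one_le_boundedRatio {η : ℝ≥0∞} (hη : 1 < η) : 1 ≤ boundedRatio η := by
  unfold boundedRatio
  split_ifs with h
  · rfl
  · have : 1 < η.toReal := by
      rw [← ENNReal.toReal_one]
      exact (ENNReal.toReal_lt_toReal (by simp) h).2 hη
    rw [le_div_iff₀ (by linarith)]
    linarith

/-- The array `[A, B; C, D]` stacked on the identity. -/
noncomputable def stackIdentity {n m : ℕ} (A : Matrix (Fin n) (Fin n) ℂ)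
    (B : Matrix (Fin n) (Fin m) ℂ) (C : Matrix (Fin m) (Fin n) ℂ) (D : Matrix (Fin m) (Fin m) ℂ) :
    Matrix ((Fin n ⊕ Fin m) ⊕ (Fin n ⊕ Fin m)) (Fin n ⊕ Fin m) ℂ :=
  Matrix.fromRows (Matrix.fromBlocks A B C D) (Matrix.fromBlocks 1 0 0 1)

/-- The matrix inequality is the dissipation inequality for the storage function `x* H x`. -/
theorem posSemidef_weight_iff {n m : ℕ} {η : ℝ≥0∞} (hη : 1 < η) {H : Matrix (Fin n) (Fin n) ℂ}
    (hH : H.IsHermitian) (A : Matrix (Fin n) (Fin n) ℂ) (B : Matrix (Fin n) (Fin m) ℂ)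
    (C : Matrix (Fin m) (Fin n) ℂ) (D : Matrix (Fin m) (Fin m) ℂ) :
    ((stackIdentity A B C D).conjTranspose * weight m η H *
      stackIdentity A B C D).PosSemidef ↔
    ∀ x u, 2 * (star x ⬝ᵥ H.mulVec (A.mulVec x + B.mulVec u)).re
      + boundedRatio η * sqNorm (C.mulVec x + D.mulVec u) ≤ sqNorm u := by
  set M := stackIdentity A B C D with hM
  have hherm : (weight m η H).IsHermitian := by
    unfold weight
    refine Matrix.IsHermitian.fromBlocks ?_ ?_ ?_
    · refine Matrix.IsHermitian.fromBlocks ?_ ?_ ?_ <;>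
        simp [Matrix.IsHermitian, Matrix.conjTranspose_smul]
    · simp [Matrix.fromBlocks_conjTranspose, hH.eq]
    · refine Matrix.IsHermitian.fromBlocks ?_ ?_ ?_ <;> simp [Matrix.IsHermitian]
  have hq : ∀ x u, star (Sum.elim x u) ⬝ᵥ (M.conjTranspose * weight m η H * M).mulVec (Sum.elim x u)
      = ((sqNorm u - 2 * (star x ⬝ᵥ H.mulVec (A.mulVec x + B.mulVec u)).re
        - boundedRatio η * sqNorm (C.mulVec x + D.mulVec u) : ℝ) : ℂ) := by
    intro x u
    have hMv : M.mulVec (Sum.elim x u) = Sum.elim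
        (Sum.elim (A.mulVec x + B.mulVec u) (C.mulVec x + D.mulVec u)) (Sum.elim x u) := by
      rw [hM, stackIdentity, Matrix.fromRows_mulVec, Matrix.fromBlocks_mulVec, Matrix.fromBlocks_mulVec]
      simp
    have hW : ∀ (p : Fin n → ℂ) (y : Fin m → ℂ), (weight m η H).mulVec
        (Sum.elim (Sum.elim p y) (Sum.elim x u)) =
        Sum.elim (Sum.elim (-(H.mulVec x)) (-(boundedRatio η : ℂ) • y))
          (Sum.elim (-(H.mulVec p)) u) := by
      intro p y
      unfold weight
      rw [Matrix.fromBlocks_mulVec]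
      ext ((i | i) | (i | i)) <;>
        simp [Matrix.fromBlocks_mulVec, weightRatio_eq_neg hη, Matrix.smul_mulVec,
          Matrix.neg_mulVec]
    have hst : ∀ {α β : Type} (f : α → ℂ) (g : β → ℂ),
        star (Sum.elim f g) = Sum.elim (star f) (star g) := by
      intro α β f g
      ext i
      cases i <;> rfl
    have hdot : ∀ {α β : Type} [Fintype α] [Fintype β] (f f' : α → ℂ) (g g' : β → ℂ),
        Sum.elim f g ⬝ᵥ Sum.elim f' g' = f ⬝ᵥ f' + g ⬝ᵥ g' := by
      intros
      simp [dotProduct, Fintype.sum_sum_type]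
    rw [← Matrix.mulVec_mulVec, ← Matrix.mulVec_mulVec, Matrix.dotProduct_mulVec,
      ← Matrix.star_mulVec, hMv, hW]
    simp only [hst, hdot, dotProduct_neg, dotProduct_smul,
      star_dotProduct_self]
    set p := A.mulVec x + B.mulVec u
    have hconj : star p ⬝ᵥ H.mulVec x = star (star x ⬝ᵥ H.mulVec p) := by
      rw [Matrix.star_dotProduct, Matrix.star_mulVec, hH.eq, Matrix.dotProduct_mulVec]
    rw [hconj]
    refine Complex.ext ?_ (by simp)
    simp
    ring
  rw [Matrix.posSemidef_iff_dotProduct_mulVec]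
  constructor
  · rintro ⟨-, h⟩ x u
    have := h (Sum.elim x u)
    rw [hq] at this
    linarith [Complex.zero_le_real.1 this]
  · intro h
    refine ⟨Matrix.isHermitian_conjTranspose_mul_mul M hherm, fun w => ?_⟩
    rw [← Sum.elim_comp_inl_inr w, hq]
    exact Complex.zero_le_real.2 (by linarith [h (w ∘ Sum.inl) (w ∘ Sum.inr)])

/-! ### Mean squares on circles -/

section

open Metric

/-- On a circle about `0`, the conjugate of a polynomial is orthogonal to a holomorphic function
vanishing at the centre, so adding the latter increases the mean square. -/
theorem circleAverage_sq_conj_add (p : Polynomial ℂ) {g : ℂ → ℂ} {r : ℝ} (hr : 0 < r)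
    (hc : ContinuousOn g (closedBall 0 r)) (hd : DifferentiableOn ℂ g (ball 0 r)) (hg : g 0 = 0) :
    Real.circleAverage (fun z => ‖star (p.eval z) + g z‖ ^ 2) 0 r =
      Real.circleAverage (fun z => ‖p.eval z‖ ^ 2) 0 r +
        Real.circleAverage (fun z => ‖g z‖ ^ 2) 0 r := by
  have hcs : ContinuousOn g (sphere 0 r) := hc.mono sphere_subset_closedBall
  have hp : Continuous fun z => p.eval z := p.continuous
  have i1 : CircleIntegrable (fun z => ‖p.eval z‖ ^ 2) 0 r :=
    (by fun_prop : Continuous _).continuousOn.circleIntegrable hr.le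
  have i2 : CircleIntegrable (fun z => ‖g z‖ ^ 2) 0 r :=
    (by fun_prop : ContinuousOn _ _).circleIntegrable hr.le
  have i3 : CircleIntegrable (fun z => p.eval z * g z) 0 r :=
    (hp.continuousOn.mul hcs).circleIntegrable hr.le
  have i4 : CircleIntegrable (fun z => 2 * (p.eval z * g z).re) 0 r :=
    (continuousOn_const.mul (Complex.continuous_re.comp_continuousOn
      (hp.continuousOn.mul hcs))).circleIntegrable hr.le
  have hexp : (fun z => ‖star (p.eval z) + g z‖ ^ 2) =
      fun z => (‖p.eval z‖ ^ 2 + ‖g z‖ ^ 2) + 2 * (p.eval z * g z).re := by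
    funext z
    rw [Complex.sq_norm, Complex.sq_norm, Complex.sq_norm, Complex.normSq_apply,
      Complex.normSq_apply, Complex.normSq_apply]
    simp
    ring
  have hzero : Real.circleAverage (fun z => p.eval z * g z) 0 r = 0 := by
    have h := DiffContOnCl.circleAverage (f := fun z => p.eval z * g z) (c := 0) (R := r) ?_
    · rw [h, hg, mul_zero]
    · rw [abs_of_pos hr]
      refine ⟨p.differentiable.differentiableOn.mul hd, ?_⟩
      rw [closure_ball _ hr.ne']
      exact hp.continuousOn.mul hc
  have hre : Real.circleAverage (fun z => 2 * (p.eval z * g z).re) 0 r = 0 := by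
    have h := ContinuousLinearMap.circleAverage_comp_comm (2 • Complex.reCLM) i3
    rw [hzero, map_zero] at h
    rw [← h]
    congr 1
    funext z
    simp
  have i12 : CircleIntegrable (fun z => ‖p.eval z‖ ^ 2 + ‖g z‖ ^ 2) 0 r := i1.add i2
  rw [hexp, Real.circleAverage_fun_add i12 i4, Real.circleAverage_fun_add i1 i2, hre,
    add_zero]

theorem circleAverage_sq_polynomial (p : Polynomial ℂ) (r : ℝ) {N : ℕ} (hN : p.natDegree < N) :
    Real.circleAverage (fun z => ‖p.eval z‖ ^ 2) 0 r =
      ∑ k ∈ Finset.range N, ‖p.coeff k‖ ^ 2 * (r ^ 2) ^ k := by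
  have h := (p.comp (Polynomial.C (r : ℂ) * Polynomial.X)).sum_sq_norm_coeff_eq_circleAverage
  rw [Real.circleAverage_eq_circleAverage_zero_one]
  simp only [Polynomial.eval_comp, Polynomial.eval_mul, Polynomial.eval_C, Polynomial.eval_X,
    Polynomial.comp_C_mul_X_coeff] at h
  simp only [add_zero]
  rw [← h]
  have hsub : (p.comp (Polynomial.C (r : ℂ) * Polynomial.X)).support ⊆ Finset.range N := by
    intro k hk
    rw [Polynomial.mem_support_iff, Polynomial.comp_C_mul_X_coeff] at hk
    exact Finset.mem_range.2 ((Polynomial.le_natDegree_of_ne_zero (left_ne_zero_of_mul hk)).trans_lt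
      hN)
  rw [Finset.sum_subset hsub fun k _ hk => ?_]
  · refine Finset.sum_congr rfl fun k _ => ?_
    rw [norm_mul, norm_pow, mul_pow, Complex.norm_real, Real.norm_eq_abs, ← pow_mul, mul_comm k 2,
      pow_mul, sq_abs]
  · rw [Polynomial.notMem_support_iff, Polynomial.comp_C_mul_X_coeff] at hk
    simp [hk]

/-- For a trigonometric polynomial `∑ aₖ z⁻ᵏ` and a holomorphic `g` with `g 0 = 0`, the mean square
on the circle `‖z‖ = r` splits into the two separate contributions. -/
theorem circleAverage_sq_sum_inv_pow_add (a : ℕ → ℂ) (N : ℕ) {g : ℂ → ℂ} {r : ℝ} (hr : 0 < r)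
    (hc : ContinuousOn g (closedBall 0 r)) (hd : DifferentiableOn ℂ g (ball 0 r)) (hg : g 0 = 0) :
    Real.circleAverage (fun z => ‖∑ k ∈ Finset.range N, a k * (z ^ k)⁻¹ + g z‖ ^ 2) 0 r =
      ∑ k ∈ Finset.range N, ‖a k‖ ^ 2 * ((r ^ 2) ^ k)⁻¹ +
        Real.circleAverage (fun z => ‖g z‖ ^ 2) 0 r := by
  set p : Polynomial ℂ := ∑ k ∈ Finset.range N,
    Polynomial.monomial k (star (a k) * ((((r ^ 2) ^ k)⁻¹ : ℝ) : ℂ)) with hp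
  have hcoeff : ∀ k, p.coeff k = if k < N then star (a k) * ((((r ^ 2) ^ k)⁻¹ : ℝ) : ℂ) else 0 := by
    intro k
    simp [hp, Polynomial.finsetSum_coeff, Polynomial.coeff_monomial]
  have hdeg : p.natDegree < N + 1 := by
    rw [Nat.lt_succ_iff, Polynomial.natDegree_le_iff_coeff_eq_zero]
    intro k hk
    rw [hcoeff, if_neg (by omega)]
  -- On the circle `conj z = r² / z`.
  have hon : Set.EqOn (fun z => ‖∑ k ∈ Finset.range N, a k * (z ^ k)⁻¹ + g z‖ ^ 2)
      (fun z => ‖star (p.eval z) + g z‖ ^ 2) (sphere 0 |r|) := by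
    intro z hz
    have hz' : ‖z‖ = r := by simpa [abs_of_pos hr] using hz
    have hz0 : z ≠ 0 := by
      rintro rfl
      simp at hz'
      exact hr.ne hz'
    have hconj : star z = ((r ^ 2 : ℝ) : ℂ) * z⁻¹ := by
      rw [← div_eq_mul_inv, eq_div_iff hz0, ← hz', Complex.star_def, Complex.conj_mul']
      simp
    have : star (p.eval z) = ∑ k ∈ Finset.range N, a k * (z ^ k)⁻¹ := by
      rw [hp, Polynomial.eval_finsetSum, star_sum]
      refine Finset.sum_congr rfl fun k _ => ?_
      have hr2 : (((r ^ 2 : ℝ) : ℂ)) ≠ 0 := by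
        exact_mod_cast (pow_pos hr 2).ne'
      rw [Polynomial.eval_monomial, star_mul', star_mul', star_star, star_pow, hconj, mul_pow,
        Complex.star_def, Complex.conj_ofReal, Complex.ofReal_inv, Complex.ofReal_pow, inv_pow,
        mul_assoc, inv_mul_cancel_left₀ (pow_ne_zero _ hr2)]
    simp only [this]
  rw [Real.circleAverage_congr_sphere hon, circleAverage_sq_conj_add p hr hc hd hg,
    circleAverage_sq_polynomial p r hdeg, Finset.sum_range_succ, hcoeff N]
  congr 1
  simp only [lt_irrefl, if_false, norm_zero, ne_eq, OfNat.ofNat_ne_zero, not_false_eq_true,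
    zero_pow, zero_mul, add_zero]
  refine Finset.sum_congr rfl fun k hk => ?_
  rw [hcoeff, if_pos (Finset.mem_range.1 hk), norm_mul, norm_star, Complex.norm_real,
    Real.norm_of_nonneg (by positivity), mul_pow]
  have : ((r ^ 2) ^ k) ≠ 0 := by positivity
  field_simp

end

/-! ### Input sequences of a discrete-time system -/

section

open Metric Filter Topology

section Inverse

theorem continuous_det_one_sub_smul {n : ℕ} (A : Matrix (Fin n) (Fin n) ℂ) :
    Continuous fun z : ℂ => (1 - z • A).det := by
  fun_prop

theorem eventually_isUnit_det_one_sub_smul {n : ℕ} (A : Matrix (Fin n) (Fin n) ℂ) :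
    ∀ᶠ z in 𝓝 (0 : ℂ), IsUnit (1 - z • A).det := by
  have h := (continuous_det_one_sub_smul A).continuousAt (x := 0)
  have h0 : (1 - (0 : ℂ) • A).det ≠ 0 := by simp
  filter_upwards [h.eventually_ne h0] with z hz
  exact isUnit_iff_ne_zero.2 hz

open scoped Matrix.Norms.Operator in
theorem differentiableAt_inv_one_sub_smul {n : ℕ} (A : Matrix (Fin n) (Fin n) ℂ) (i j : Fin n) :
    DifferentiableAt ℂ (fun z : ℂ => ((1 - z • A)⁻¹ : Matrix (Fin n) (Fin n) ℂ) i j) 0 := by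
  have h1 : DifferentiableAt ℂ (fun z : ℂ => Ring.inverse (1 - z • A)) 0 := by
    have h2 : DifferentiableAt ℂ (Ring.inverse : Matrix (Fin n) (Fin n) ℂ → _) (1 - (0 : ℂ) • A) := by
      rw [zero_smul, sub_zero]
      exact differentiableAt_inverse isUnit_one
    have h3 : DifferentiableAt ℂ (fun z : ℂ => 1 - z • A) 0 :=
      (differentiableAt_const _).sub (differentiableAt_id.smul_const A)
    exact DifferentiableAt.comp (0 : ℂ) h2 h3
  simp only [Matrix.nonsing_inv_eq_ringInverse]
  have h3 := (Matrix.entryLinearMap ℂ ℂ i j).toContinuousLinearMap.differentiableAt.comp (0 : ℂ) h1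
  exact h3

end Inverse

section Inputs

variable {n m : ℕ} (A : Matrix (Fin n) (Fin n) ℂ) (B : Matrix (Fin n) (Fin m) ℂ)
  (C : Matrix (Fin m) (Fin n) ℂ) (D : Matrix (Fin m) (Fin m) ℂ)

/-- Finitely supported input sequences in reversed time: the value at `k` is the input applied
`k + 1` steps before the present. -/
abbrev Inputs (m : ℕ) : Type := ℕ →₀ (Fin m → ℂ)

/-- Delay of a reversed-time sequence by one step. -/
noncomputable def delay (m : ℕ) : Inputs m →ₗ[ℂ] Inputs m :=
  Finsupp.lmapDomain (Fin m → ℂ) ℂ Nat.succ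

/-- The present state of the system `x⁺ = A x + B u`, started at rest, under a given input. -/
noncomputable def reach : Inputs m →ₗ[ℂ] (Fin n → ℂ) :=
  Finsupp.lsum ℂ fun k => (A ^ k * B).mulVecLin

/-- The output sequence `y = C x + D u`, in reversed time, of the system `x⁺ = A x + B u` started
at rest. -/
noncomputable def output : Inputs m →ₗ[ℂ] Inputs m :=
  Finsupp.lsum ℂ fun k => Finsupp.lsingle k ∘ₗ D.mulVecLin +
    ∑ j ∈ Finset.range k, Finsupp.lsingle j ∘ₗ (C * A ^ (k - 1 - j) * B).mulVecLin

/-- The Laurent polynomial `∑ vₖ z⁻ᵏ` of a reversed-time sequence. -/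
noncomputable def laurent (z : ℂ) : Inputs m →ₗ[ℂ] (Fin m → ℂ) :=
  Finsupp.lsum ℂ fun k => (z ^ k)⁻¹ • LinearMap.id

theorem delay_single (k : ℕ) (u : Fin m → ℂ) :
    delay m (Finsupp.single k u) = Finsupp.single (k + 1) u := by
  simp [delay]

theorem Inputs.induction {p : Inputs m → Prop} (v : Inputs m)
    (single : ∀ u, p (Finsupp.single 0 u)) (delay : ∀ v, p v → p (delay m v))
    (add : ∀ v w, p v → p w → p (v + w)) : p v := by
  induction v using Finsupp.induction_linear with
  | zero => simpa using single 0
  | add v w hv hw => exact add v w hv hw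
  | single k u =>
    induction k with
    | zero => exact single u
    | succ k ih => simpa only [delay_single] using delay _ ih

theorem reach_single_zero (u : Fin m → ℂ) : reach A B (Finsupp.single 0 u) = B.mulVec u := by
  simp [reach]

theorem reach_delay (v : Inputs m) : reach A B (delay m v) = A.mulVec (reach A B v) := by
  induction v using Finsupp.induction_linear with
  | zero => simp
  | add v w hv hw => rw [map_add, map_add, hv, hw, map_add, Matrix.mulVec_add]
  | single k u => simp [delay_single, reach, pow_succ']

theorem output_single_zero (u : Fin m → ℂ) :
    output A B C D (Finsupp.single 0 u) = Finsupp.single 0 (D.mulVec u) := by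
  simp [output]

theorem output_delay (v : Inputs m) :
    output A B C D (delay m v) =
      Finsupp.single 0 (C.mulVec (reach A B v)) + delay m (output A B C D v) := by
  induction v using Finsupp.induction_linear with
  | zero => simp
  | add v w hv hw =>
    rw [map_add, map_add, hv, hw, map_add, map_add, map_add, Matrix.mulVec_add, Finsupp.single_add]
    abel
  | single k u =>
    simp only [delay_single, output, reach, Finsupp.lsum_single, LinearMap.add_apply,
      LinearMap.sum_apply, LinearMap.comp_apply, Finsupp.lsingle_apply, Matrix.mulVecLin_apply,
      map_add, map_sum, Finset.sum_range_succ']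
    simp only [Nat.add_sub_cancel, Nat.sub_zero, Matrix.mulVec_mulVec, Matrix.mul_assoc]
    have : ∀ j ∈ Finset.range k, k - (j + 1) = k - 1 - j := fun j _ => by omega
    rw [Finset.sum_congr rfl fun j hj => by rw [this j hj]]
    abel

theorem laurent_single_zero (z : ℂ) (u : Fin m → ℂ) : laurent z (Finsupp.single 0 u) = u := by
  simp [laurent]

theorem laurent_delay (z : ℂ) (v : Inputs m) : laurent z (delay m v) = z⁻¹ • laurent z v := by
  induction v using Finsupp.induction_linear with
  | zero => simp
  | add v w hv hw => rw [map_add, map_add, hv, hw, map_add, smul_add]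
  | single k u => simp [delay_single, laurent, pow_succ, smul_smul, mul_comm]

theorem laurent_eq_sum (z : ℂ) {v : Inputs m} {N : ℕ} (hv : v.support ⊆ Finset.range N) :
    laurent z v = ∑ k ∈ Finset.range N, (z ^ k)⁻¹ • v k := by
  rw [laurent, Finsupp.lsum_apply, Finsupp.sum_of_support_subset _ hv _ (by simp)]
  simp

/-- Multiplying the input by the transfer function gives the output up to the free response of the
present state. -/
theorem transfer_mulVec_laurent {z : ℂ} (hz : z ≠ 0) (hdet : IsUnit (1 - z • A).det)
    (v : Inputs m) :
    (D + z • (C * (1 - z • A)⁻¹ * B)).mulVec (laurent z v) =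
      laurent z (output A B C D v) + z • C.mulVec ((1 - z • A)⁻¹.mulVec (reach A B v)) := by
  set Q := (1 - z • A)⁻¹ with hQ
  have hQA : ∀ x, Q.mulVec x = x + z • Q.mulVec (A.mulVec x) := by
    intro x
    have h1 : Q * (1 - z • A) = 1 := Matrix.nonsing_inv_mul _ hdet
    have h2 : Q = 1 + z • (Q * A) := by
      rw [← h1, Matrix.mul_sub, Matrix.mul_one, Matrix.mul_smul]
      abel
    conv_lhs => rw [h2]
    simp [Matrix.add_mulVec, Matrix.smul_mulVec]
  induction v using Inputs.induction with
  | single u =>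
    simp [laurent_single_zero, output_single_zero, reach_single_zero, Matrix.add_mulVec,
      Matrix.smul_mulVec, Matrix.mul_assoc]
  | delay v ih =>
    rw [laurent_delay, Matrix.mulVec_smul, ih, output_delay, map_add, laurent_delay,
      laurent_single_zero, reach_delay, smul_add, smul_smul, inv_mul_cancel₀ hz, one_smul,
      hQA (reach A B v), Matrix.mulVec_add, Matrix.mulVec_smul]
    abel
  | add v w hv hw =>
    rw [map_add, Matrix.mulVec_add, hv, hw, map_add, map_add, map_add, Matrix.mulVec_add,
      Matrix.mulVec_add, smul_add]
    abel

end Inputs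

end

/-! ### Contractivity of the input-output map -/

section

open Metric Filter Topology

variable {n m : ℕ} {A : Matrix (Fin n) (Fin n) ℂ} {B : Matrix (Fin n) (Fin m) ℂ}
  {C : Matrix (Fin m) (Fin n) ℂ} {D : Matrix (Fin m) (Fin m) ℂ}
  {Ψ : ℂ → Matrix (Fin m) (Fin m) ℂ}

theorem differentiableOn_laurent (v : Inputs m) (i : Fin m) :
    DifferentiableOn ℂ (fun z => laurent z v i) {0}ᶜ := by
  obtain ⟨N, hN⟩ := v.support.exists_nat_subset_range
  have : (fun z => laurent z v i) = fun z => ∑ k ∈ Finset.range N, (z ^ k)⁻¹ * v k i := by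
    funext z
    rw [laurent_eq_sum z hN]
    simp
  rw [this]
  refine DifferentiableOn.fun_sum fun k _ => DifferentiableOn.mul_const ?_ _
  exact (differentiableOn_id.pow k).inv fun z hz => pow_ne_zero k hz

/-- The `i`-th coordinate of the free response `Ψ û - ŷ`, with `û` and `ŷ` the Laurent polynomials
of the input and the output, extended by `0` to the origin. -/
noncomputable def freeResponse (A : Matrix (Fin n) (Fin n) ℂ) (B : Matrix (Fin n) (Fin m) ℂ)
    (C : Matrix (Fin m) (Fin n) ℂ) (D : Matrix (Fin m) (Fin m) ℂ)
    (Ψ : ℂ → Matrix (Fin m) (Fin m) ℂ) (v : Inputs m) (i : Fin m) (z : ℂ) : ℂ :=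
  if z = 0 then 0 else ((Ψ z).mulVec (laurent z v) - laurent z (output A B C D v)) i

theorem differentiableOn_freeResponse
    (hd : ∀ i j, DifferentiableOn ℂ (fun z => Ψ z i j) (ball 0 1))
    (hnear : ∀ᶠ z in 𝓝 (0 : ℂ), Ψ z = D + z • (C * (1 - z • A)⁻¹ * B))
    (v : Inputs m) (i : Fin m) :
    DifferentiableOn ℂ (freeResponse A B C D Ψ v i) (ball 0 1) := by
  intro z hz
  refine DifferentiableAt.differentiableWithinAt ?_
  by_cases h0 : z = 0
  · subst h0
    have hev : freeResponse A B C D Ψ v i =ᶠ[𝓝 0]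
        fun z => z * ∑ j, C i j * ∑ l, (1 - z • A)⁻¹ j l * reach A B v l := by
      filter_upwards [hnear, eventually_isUnit_det_one_sub_smul A] with z hΨ hdet
      by_cases hz0 : z = 0
      · simp [freeResponse, hz0]
      · rw [freeResponse, if_neg hz0, hΨ, transfer_mulVec_laurent A B C D hz0 hdet,
          add_sub_cancel_left]
        rfl
    refine DifferentiableAt.congr_of_eventuallyEq ?_ hev
    refine differentiableAt_id.mul (DifferentiableAt.fun_sum fun j _ => ?_)
    refine DifferentiableAt.const_mul (DifferentiableAt.fun_sum fun l _ => ?_) _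
    exact (differentiableAt_inv_one_sub_smul A j l).mul_const _
  · have hev : freeResponse A B C D Ψ v i =ᶠ[𝓝 z]
        fun z => ∑ j, Ψ z i j * laurent z v j - laurent z (output A B C D v) i := by
      filter_upwards [isOpen_compl_singleton.mem_nhds (show z ∈ ({0}ᶜ : Set ℂ) from h0)] with w hw
      rw [freeResponse, if_neg (show ¬w = 0 from hw)]
      rfl
    have hl : ∀ (w : Inputs m) j, DifferentiableAt ℂ (fun z => laurent z w j) z := fun w j =>
      (differentiableOn_laurent w j).differentiableAt
        (isOpen_compl_singleton.mem_nhds (show z ∈ ({0}ᶜ : Set ℂ) from h0))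
    refine DifferentiableAt.congr_of_eventuallyEq ?_ hev
    refine DifferentiableAt.sub (DifferentiableAt.fun_sum fun j _ => ?_) (hl _ i)
    exact ((hd i j).differentiableAt (isOpen_ball.mem_nhds hz)).mul (hl _ j)

theorem circleAverage_sq_laurent {N : ℕ} {v : Inputs m} (hv : v.support ⊆ Finset.range N) {r : ℝ}
    (hr : 0 < r) (i : Fin m) :
    Real.circleAverage (fun z => ‖laurent z v i‖ ^ 2) 0 r =
      ∑ k ∈ Finset.range N, ‖v k i‖ ^ 2 * ((r ^ 2) ^ k)⁻¹ := by
  have h := circleAverage_sq_sum_inv_pow_add (fun k => v k i) N (g := fun _ => 0) hr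
    continuousOn_const (differentiableOn_const 0) rfl
  simp only [add_zero, norm_zero, ne_eq, OfNat.ofNat_ne_zero, not_false_eq_true, zero_pow,
    Real.circleAverage_const] at h
  rw [← h]
  congr 1
  funext z
  simp only [laurent_eq_sum z hv, Finset.sum_apply, Pi.smul_apply, smul_eq_mul, mul_comm]

/-- The mean square of `Ψ û` dominates that of `ŷ`, since the free response `Ψ û - ŷ` is
holomorphic in the disk and vanishes at the origin. -/
theorem sum_le_circleAverage_sq
    (hd : ∀ i j, DifferentiableOn ℂ (fun z => Ψ z i j) (ball 0 1))
    (hnear : ∀ᶠ z in 𝓝 (0 : ℂ), Ψ z = D + z • (C * (1 - z • A)⁻¹ * B))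
    {N : ℕ} {v : Inputs m} (hy : (output A B C D v).support ⊆ Finset.range N) {r : ℝ}
    (hr : 0 < r) (hr1 : r < 1) (i : Fin m) :
    ∑ k ∈ Finset.range N, ‖output A B C D v k i‖ ^ 2 * ((r ^ 2) ^ k)⁻¹ ≤
      Real.circleAverage (fun z => ‖(Ψ z).mulVec (laurent z v) i‖ ^ 2) 0 r := by
  have hg := differentiableOn_freeResponse hd hnear v i
  have h := circleAverage_sq_sum_inv_pow_add (fun k => output A B C D v k i) N
    (g := freeResponse A B C D Ψ v i) hr
    (hg.continuousOn.mono (closedBall_subset_ball hr1)) (hg.mono (ball_subset_ball hr1.le))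
    (by simp [freeResponse])
  have h2 : 0 ≤ Real.circleAverage (fun z => ‖freeResponse A B C D Ψ v i z‖ ^ 2) 0 r :=
    Real.circleAverage_nonneg_of_nonneg fun z _ => sq_nonneg _
  have h3 : Set.EqOn (fun z => ‖∑ k ∈ Finset.range N, output A B C D v k i * (z ^ k)⁻¹ +
      freeResponse A B C D Ψ v i z‖ ^ 2)
      (fun z => ‖(Ψ z).mulVec (laurent z v) i‖ ^ 2) (sphere 0 |r|) := by
    intro z hz
    have hz0 : z ≠ 0 := by
      rintro rfl
      rw [abs_of_pos hr] at hz
      simp [hr.ne] at hz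
    simp only [freeResponse, if_neg hz0, laurent_eq_sum z hy, Pi.sub_apply, Finset.sum_apply,
      Pi.smul_apply, smul_eq_mul, mul_comm, add_sub_cancel]
  rw [Real.circleAverage_congr_sphere h3] at h
  linarith

/-- The input-output map is contractive for the weights `r⁻²ᵏ`: compare the mean squares of `û`,
`Ψ û` and `ŷ` on the circle of radius `r`. -/
theorem weighted_output_le
    (hd : ∀ i j, DifferentiableOn ℂ (fun z => Ψ z i j) (ball 0 1))
    (hnear : ∀ᶠ z in 𝓝 (0 : ℂ), Ψ z = D + z • (C * (1 - z • A)⁻¹ * B))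
    {c : ℝ} (hc : 0 ≤ c)
    (hcontr : ∀ z ∈ ball (0 : ℂ) 1, ∀ u, c * sqNorm ((Ψ z).mulVec u) ≤ sqNorm u)
    {N : ℕ} {v : Inputs m} (hv : v.support ⊆ Finset.range N)
    (hy : (output A B C D v).support ⊆ Finset.range N) {r : ℝ} (hr : 0 < r) (hr1 : r < 1) :
    c * ∑ k ∈ Finset.range N, sqNorm (output A B C D v k) * ((r ^ 2) ^ k)⁻¹ ≤
      ∑ k ∈ Finset.range N, sqNorm (v k) * ((r ^ 2) ^ k)⁻¹ := by
  have hsph : sphere (0 : ℂ) r ⊆ {0}ᶜ := by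
    rintro z hz rfl
    simp [hr.ne] at hz
  have hsph' : sphere (0 : ℂ) r ⊆ ball 0 1 := sphere_subset_closedBall.trans
    (closedBall_subset_ball hr1)
  have hcl : ∀ i, ContinuousOn (fun z => laurent z v i) (sphere 0 r) := fun i =>
    (differentiableOn_laurent v i).continuousOn.mono hsph
  have hcΨ : ∀ i, ContinuousOn (fun z => (Ψ z).mulVec (laurent z v) i) (sphere 0 r) := by
    intro i
    have : ContinuousOn (fun z => ∑ j, Ψ z i j * laurent z v j) (sphere 0 r) :=
      continuousOn_finsetSum _ fun j _ => ((hd i j).continuousOn.mono hsph').mul (hcl j)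
    exact this
  have i1 : ∀ i, CircleIntegrable (fun z => ‖laurent z v i‖ ^ 2) 0 r := fun i =>
    ((hcl i).norm.pow 2).circleIntegrable hr.le
  have i2 : ∀ i, CircleIntegrable (fun z => ‖(Ψ z).mulVec (laurent z v) i‖ ^ 2) 0 r := fun i =>
    ((hcΨ i).norm.pow 2).circleIntegrable hr.le
  have hswap : ∀ w : Inputs m, ∑ k ∈ Finset.range N, sqNorm (w k) * ((r ^ 2) ^ k)⁻¹ =
      ∑ i, ∑ k ∈ Finset.range N, ‖w k i‖ ^ 2 * ((r ^ 2) ^ k)⁻¹ := by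
    intro w
    rw [Finset.sum_comm]
    simp only [sqNorm, Finset.sum_mul]
  rw [hswap, hswap]
  calc c * ∑ i, ∑ k ∈ Finset.range N, ‖output A B C D v k i‖ ^ 2 * ((r ^ 2) ^ k)⁻¹
      ≤ c * ∑ i, Real.circleAverage (fun z => ‖(Ψ z).mulVec (laurent z v) i‖ ^ 2) 0 r := by
        gcongr with i _
        exact sum_le_circleAverage_sq hd hnear hy hr hr1 i
    _ = Real.circleAverage (fun z => c • sqNorm ((Ψ z).mulVec (laurent z v))) 0 r := by
        rw [Real.circleAverage_fun_smul]
        simp only [sqNorm]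
        rw [Real.circleAverage_fun_sum fun i _ => i2 i, smul_eq_mul]
    _ ≤ Real.circleAverage (fun z => sqNorm (laurent z v)) 0 r := by
        refine Real.circleAverage_mono ?_ ?_ fun z hz => ?_
        · refine ContinuousOn.circleIntegrable hr.le (ContinuousOn.const_smul ?_ c)
          exact continuousOn_finsetSum _ fun i _ => (hcΨ i).norm.pow 2
        · exact ContinuousOn.circleIntegrable hr.le
            (continuousOn_finsetSum _ fun i _ => (hcl i).norm.pow 2)
        · exact hcontr z (hsph' (by rwa [abs_of_pos hr] at hz)) _
    _ = ∑ i, ∑ k ∈ Finset.range N, ‖v k i‖ ^ 2 * ((r ^ 2) ^ k)⁻¹ := by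
        simp only [sqNorm]
        rw [Real.circleAverage_fun_sum fun i _ => i1 i]
        exact Finset.sum_congr rfl fun i _ => circleAverage_sq_laurent hv hr i

/-- A system whose transfer function is contractive on the unit disk has a contractive input-output
map on finitely supported inputs. The function `Ψ` continues the transfer function from a
neighbourhood of the origin, so `A` itself may have eigenvalues outside the unit disk. -/
theorem output_le
    (hd : ∀ i j, DifferentiableOn ℂ (fun z => Ψ z i j) (ball 0 1))
    (hnear : ∀ᶠ z in 𝓝 (0 : ℂ), Ψ z = D + z • (C * (1 - z • A)⁻¹ * B))
    {c : ℝ} (hc : 0 ≤ c)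
    (hcontr : ∀ z ∈ ball (0 : ℂ) 1, ∀ u, c * sqNorm ((Ψ z).mulVec u) ≤ sqNorm u)
    {N : ℕ} {v : Inputs m} (hv : v.support ⊆ Finset.range N)
    (hy : (output A B C D v).support ⊆ Finset.range N) :
    c * ∑ k ∈ Finset.range N, sqNorm (output A B C D v k) ≤
      ∑ k ∈ Finset.range N, sqNorm (v k) := by
  have hcont : ∀ w : Inputs m, Tendsto
      (fun r : ℝ => ∑ k ∈ Finset.range N, sqNorm (w k) * ((r ^ 2) ^ k)⁻¹) (𝓝[<] 1)
      (𝓝 (∑ k ∈ Finset.range N, sqNorm (w k))) := by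
    intro w
    have : ContinuousAt
        (fun r : ℝ => ∑ k ∈ Finset.range N, sqNorm (w k) * ((r ^ 2) ^ k)⁻¹) 1 := by
      refine tendsto_finsetSum _ fun k _ => ContinuousAt.mul continuousAt_const ?_
      exact ContinuousAt.inv₀ (by fun_prop) (by simp)
    have h2 := this.tendsto.mono_left (nhdsWithin_le_nhds (s := Set.Iio 1))
    simpa using h2
  refine le_of_tendsto_of_tendsto ((hcont _).const_mul c) (hcont v) ?_
  filter_upwards [Ioo_mem_nhdsLT (show (0 : ℝ) < 1 by norm_num)] with r hr
  exact weighted_output_le hd hnear hc hcontr hv hy hr.1 hr.2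

end

/-! ### Minimizing a semidefinite form over fibres -/

open scoped InnerProductSpace in
/-- The infimum of a positive semidefinite form over the fibres of a surjective linear map is again
a positive semidefinite form. In the Hilbert space completion, the minimal value on a fibre is the
squared distance to the closure of the kernel. -/
theorem exists_posSemidef_fiberInf {V : Type*} [AddCommGroup V] [Module ℂ V]
    (core : PreInnerProductSpace.Core ℂ V) {n : ℕ} (R : V →ₗ[ℂ] (Fin n → ℂ))
    (hR : Function.Surjective R) :
    ∃ H : Matrix (Fin n) (Fin n) ℂ, H.PosSemidef ∧
      (∀ v, quadForm H (R v) ≤ (core.inner v v).re) ∧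
      ∀ x, ∀ ε > 0, ∃ v, R v = x ∧ (core.inner v v).re < quadForm H x + ε := by
  let _ : SeminormedAddCommGroup V := InnerProductSpace.Core.toSeminormedAddCommGroup (c := core)
  let _ : InnerProductSpace ℂ V := InnerProductSpace.ofCore core
  have hinner : ∀ v : V, (core.inner v v).re = ‖v‖ ^ 2 := fun v =>
    (norm_sq_eq_re_inner (𝕜 := ℂ) v).symm
  let ι : V →ₗᵢ[ℂ] UniformSpace.Completion V := UniformSpace.Completion.toComplₗᵢ
  let K : Submodule ℂ (UniformSpace.Completion V) :=
    ((LinearMap.ker R).map ι.toLinearMap).topologicalClosure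
  have : CompleteSpace K := (Submodule.isClosed_topologicalClosure _).completeSpace_coe
  obtain ⟨σ, hσ⟩ := R.exists_rightInverse_of_surjective (LinearMap.range_eq_top.2 hR)
  let T : (Fin n → ℂ) →ₗ[ℂ] UniformSpace.Completion V :=
    Kᗮ.starProjection.toLinearMap ∘ₗ ι.toLinearMap ∘ₗ σ
  let b : Fin n → UniformSpace.Completion V := fun i => T (Pi.single i 1)
  have hquad : ∀ x, quadForm (Matrix.gram ℂ b) x = ‖T x‖ ^ 2 := by
    intro x
    have hx : ∑ i, x i • b i = T x := by
      simp only [b, ← map_smul, ← map_sum]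
      congr 1
      ext j
      simp [Finset.sum_apply, Pi.single_apply]
    rw [quadForm, Matrix.star_dotProduct_gram_mulVec, hx]
    exact (norm_sq_eq_re_inner (𝕜 := ℂ) (T x)).symm
  have hT : ∀ v, T (R v) = Kᗮ.starProjection (ι v) := by
    intro v
    have hmem : ι (σ (R v) - v) ∈ K := by
      refine Submodule.le_topologicalClosure _ (Submodule.mem_map_of_mem ?_)
      rw [LinearMap.mem_ker, map_sub, sub_eq_zero]
      exact LinearMap.congr_fun hσ (R v)
    have h0 : Kᗮ.starProjection (ι (σ (R v) - v)) = 0 := by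
      rw [Submodule.starProjection_apply_eq_zero_iff]
      exact Submodule.le_orthogonal_orthogonal K hmem
    rw [map_sub, map_sub, sub_eq_zero] at h0
    exact h0
  refine ⟨Matrix.gram ℂ b, Matrix.posSemidef_gram ℂ b, fun v => ?_, fun x ε hε => ?_⟩
  · rw [hquad, hinner, hT, ← ι.norm_map v]
    gcongr
    exact Submodule.norm_starProjection_apply_le _ _
  · have hmem : K.starProjection (ι (σ x)) ∈ closure ((LinearMap.ker R).map ι.toLinearMap : Set _) :=
      K.starProjection_apply_mem (ι (σ x))
    have hlim : Filter.Tendsto (fun y => ‖ι (σ x) - y‖ ^ 2) (nhds (K.starProjection (ι (σ x))))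
        (nhds (‖T x‖ ^ 2)) := by
      have hc : Continuous fun y => ‖ι (σ x) - y‖ ^ 2 := by fun_prop
      have he : ι (σ x) - K.starProjection (ι (σ x)) = T x := by
        simp [T, Submodule.starProjection_orthogonal]
      rw [← he]
      exact hc.tendsto _
    have hev := hlim.eventually (gt_mem_nhds (lt_add_of_pos_right (‖T x‖ ^ 2) hε))
    obtain ⟨y, ⟨w, hw, rfl⟩, hlt⟩ := ((mem_closure_iff_frequently.1 hmem).and_eventually hev).exists
    refine ⟨σ x - w, ?_, ?_⟩
    · rw [map_sub, LinearMap.mem_ker.1 hw, sub_zero]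
      exact LinearMap.congr_fun hσ x
    · rw [hquad, hinner, ← ι.norm_map, map_sub]
      exact hlt

/-! ### Storage functions in discrete time -/

section

open Metric Filter Topology

variable {n m : ℕ}

/-- The `ℓ²` inner product of finitely supported sequences. -/
noncomputable def seqInner (v w : Inputs m) : ℂ := v.sum fun k a => star a ⬝ᵥ w k

theorem seqInner_eq_sum {v : Inputs m} {N : ℕ} (hv : v.support ⊆ Finset.range N) (w : Inputs m) :
    seqInner v w = ∑ k ∈ Finset.range N, star (v k) ⬝ᵥ w k :=
  Finsupp.sum_of_support_subset _ hv _ (by simp)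

theorem seqInner_self {v : Inputs m} {N : ℕ} (hv : v.support ⊆ Finset.range N) :
    seqInner v v = ((∑ k ∈ Finset.range N, sqNorm (v k) : ℝ) : ℂ) := by
  rw [seqInner_eq_sum hv]
  simp [star_dotProduct_self]

theorem exists_support_subset_range (v w : Inputs m) :
    ∃ N, v.support ⊆ Finset.range N ∧ w.support ⊆ Finset.range N := by
  obtain ⟨N, hN⟩ := (v.support ∪ w.support).exists_nat_subset_range
  exact ⟨N, Finset.union_subset_left hN, Finset.union_subset_right hN⟩

theorem star_seqInner (v w : Inputs m) : star (seqInner w v) = seqInner v w := by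
  obtain ⟨N, hv, hw⟩ := exists_support_subset_range v w
  rw [seqInner_eq_sum hv, seqInner_eq_sum hw, star_sum]
  exact Finset.sum_congr rfl fun k _ => by
    rw [Matrix.star_dotProduct, star_star, dotProduct_comm]

theorem seqInner_add_left (v w x : Inputs m) :
    seqInner (v + w) x = seqInner v x + seqInner w x :=
  Finsupp.sum_add_index' (by simp) (by simp [add_dotProduct])

theorem seqInner_smul_left (a : ℂ) (v w : Inputs m) :
    seqInner (a • v) w = star a * seqInner v w := by
  rw [seqInner, Finsupp.sum_smul_index' (by simp), seqInner, Finsupp.mul_sum]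
  simp

theorem seqInner_single_add_delay (u : Fin m → ℂ) (v : Inputs m) :
    seqInner (Finsupp.single 0 u + delay m v) (Finsupp.single 0 u + delay m v) =
      sqNorm u + seqInner v v := by
  obtain ⟨N, hv, -⟩ := exists_support_subset_range v v
  have hz : (Finsupp.single 0 u + delay m v : Inputs m) 0 = u := by
    have : (delay m v) 0 = 0 := Finsupp.mapDomain_of_notMem_range _ _ (by simp)
    simp [this]
  have hs : ∀ k, (Finsupp.single 0 u + delay m v : Inputs m) (k + 1) = v k := by
    intro k
    have : (delay m v) (k + 1) = v k := Finsupp.mapDomain_apply Nat.succ_injective v k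
    simp [this]
  have hsupp : (Finsupp.single 0 u + delay m v).support ⊆ Finset.range (N + 1) := by
    intro k hk
    cases k with
    | zero => simp
    | succ k =>
      rw [Finsupp.mem_support_iff, hs, ← Finsupp.mem_support_iff] at hk
      simpa using hv hk
  rw [seqInner_self hsupp, seqInner_self hv, Finset.sum_range_succ', hz]
  simp only [hs]
  push_cast
  ring

variable {A : Matrix (Fin n) (Fin n) ℂ} {B : Matrix (Fin n) (Fin m) ℂ}
  {C : Matrix (Fin m) (Fin n) ℂ} {D : Matrix (Fin m) (Fin m) ℂ}

/-- The supplied energy `∑ ‖u‖² - c ‖y‖²`, as a positive semidefinite form on input sequences of a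
system for which it is never negative. -/
@[reducible]
noncomputable def energyCore (A : Matrix (Fin n) (Fin n) ℂ) (B : Matrix (Fin n) (Fin m) ℂ)
    (C : Matrix (Fin m) (Fin n) ℂ) (D : Matrix (Fin m) (Fin m) ℂ) (c : ℝ)
    (h : ∀ v : Inputs m, c * (seqInner (output A B C D v) (output A B C D v)).re ≤
      (seqInner v v).re) :
    PreInnerProductSpace.Core ℂ (Inputs m) where
  inner v w := seqInner v w - c * seqInner (output A B C D v) (output A B C D w)
  conj_inner_symm v w := by
    rw [map_sub, map_mul, Complex.conj_ofReal]
    congr 1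
    · exact star_seqInner v w
    · congr 1
      exact star_seqInner _ _
  re_inner_nonneg v := by
    have := h v
    simp
    linarith
  add_left v w x := by
    rw [map_add, seqInner_add_left, seqInner_add_left]
    ring
  smul_left v w a := by
    rw [map_smul, seqInner_smul_left, seqInner_smul_left]
    simp only [Complex.star_def]
    ring

theorem reach_surjective (h : Controllable A B) : Function.Surjective (reach A B) := by
  rw [← LinearMap.range_eq_top]
  refine h _ (fun u => ⟨_, reach_single_zero A B u⟩) ?_
  rintro _ ⟨v, rfl⟩
  exact ⟨_, reach_delay A B v⟩

/-- A discrete-time system with contractive transfer function has a storage function: the least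
energy needed to reach a state from rest. -/
theorem exists_discrete_storage {Ψ : ℂ → Matrix (Fin m) (Fin m) ℂ}
    (hd : ∀ i j, DifferentiableOn ℂ (fun z => Ψ z i j) (ball 0 1))
    (hnear : ∀ᶠ z in 𝓝 (0 : ℂ), Ψ z = D + z • (C * (1 - z • A)⁻¹ * B))
    {c : ℝ} (hc : 0 < c)
    (hcontr : ∀ z ∈ ball (0 : ℂ) 1, ∀ u, c * sqNorm ((Ψ z).mulVec u) ≤ sqNorm u)
    (hctrl : Controllable A B) (hobs : Observable A C) :
    ∃ H : Matrix (Fin n) (Fin n) ℂ, H.PosDef ∧ ∀ x u,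
      quadForm H (A.mulVec x + B.mulVec u) + c * sqNorm (C.mulVec x + D.mulVec u) ≤
        quadForm H x + sqNorm u := by
  have hE : ∀ v : Inputs m, c * (seqInner (output A B C D v) (output A B C D v)).re ≤
      (seqInner v v).re := by
    intro v
    obtain ⟨N, hv, hy⟩ := exists_support_subset_range v (output A B C D v)
    rw [seqInner_self hv, seqInner_self hy, Complex.ofReal_re, Complex.ofReal_re]
    exact output_le hd hnear hc.le hcontr hv hy
  obtain ⟨H, hH, hle, hlt⟩ := exists_posSemidef_fiberInf (energyCore A B C D c hE) (reach A B)
    (reach_surjective hctrl)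
  have hstore : ∀ x u, quadForm H (A.mulVec x + B.mulVec u) +
      c * sqNorm (C.mulVec x + D.mulVec u) ≤ quadForm H x + sqNorm u := by
    intro x u
    refine le_of_forall_pos_le_add fun ε hε => ?_
    obtain ⟨v, rfl, hv⟩ := hlt x ε hε
    have h1 := hle (Finsupp.single 0 u + delay m v)
    rw [map_add, reach_single_zero, reach_delay, add_comm (B.mulVec u)] at h1
    have h2 : output A B C D (Finsupp.single 0 u + delay m v) =
        Finsupp.single 0 (C.mulVec (reach A B v) + D.mulVec u) + delay m (output A B C D v) := by
      rw [map_add, output_single_zero, output_delay, Finsupp.single_add]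
      abel
    change _ ≤ (seqInner _ _ - (c : ℂ) * seqInner _ _).re at h1
    change (seqInner _ _ - (c : ℂ) * seqInner _ _).re < _ at hv
    rw [h2, seqInner_single_add_delay, seqInner_single_add_delay] at h1
    simp only [Complex.sub_re, Complex.add_re, Complex.re_ofReal_mul, Complex.ofReal_re] at h1 hv
    linarith
  refine ⟨H, ?_, hstore⟩
  have hq0 : ∀ x, 0 ≤ quadForm H x := fun x =>
    (Complex.le_def.1 (hH.dotProduct_mulVec_nonneg x)).1
  have hq : ∀ x, star x ⬝ᵥ H.mulVec x = (quadForm H x : ℂ) := fun x =>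
    Complex.ext rfl (Complex.le_def.1 (hH.dotProduct_mulVec_nonneg x)).2.symm
  have hker : ∀ x, H.mulVec x = 0 ↔ quadForm H x = 0 := fun x => by
    rw [← hH.dotProduct_mulVec_zero_iff, hq, Complex.ofReal_eq_zero]
  -- States of zero storage are unobservable: with `u = 0` nothing can be extracted from them.
  have hW : LinearMap.ker H.mulVecLin = ⊥ := by
    refine hobs _ (fun x hx => ?_) (fun x hx => ?_)
    all_goals
      rw [LinearMap.mem_ker, Matrix.mulVecLin_apply, hker] at hx
      have h := hstore x 0
      simp only [Matrix.mulVec_zero, add_zero, hx] at h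
      have h0 : sqNorm (0 : Fin m → ℂ) = 0 := by simp [sqNorm]
      have h1 := hq0 (A.mulVec x)
      have h2 := mul_nonneg hc.le (sqNorm_nonneg (C.mulVec x))
    · exact sqNorm_eq_zero ((mul_eq_zero.1 (by linarith)).resolve_left hc.ne')
    · rw [LinearMap.mem_ker, Matrix.mulVecLin_apply, hker]
      linarith
  refine Matrix.PosDef.of_dotProduct_mulVec_pos hH.1 fun x hx => ?_
  rw [hq, Complex.zero_lt_real]
  refine lt_of_le_of_ne (hq0 x) fun h => hx ?_
  have : x ∈ LinearMap.ker H.mulVecLin := by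
    rw [LinearMap.mem_ker, Matrix.mulVecLin_apply, hker, h]
  rwa [hW, Submodule.mem_bot] at this

end

/-! ### From continuous to discrete time -/

section

open Metric Filter Topology

variable {n m : ℕ} {A R : Matrix (Fin n) (Fin n) ℂ} {B : Matrix (Fin n) (Fin m) ℂ}
  {C : Matrix (Fin m) (Fin n) ℂ} {D : Matrix (Fin m) (Fin m) ℂ} {a : ℂ}

/-- A subspace invariant under an invertible matrix is invariant under the inverse. -/
theorem mulVec_mem_of_inverse_mulVec_mem {S : Matrix (Fin n) (Fin n) ℂ} (hRS : R * S = 1)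
    {W : Submodule ℂ (Fin n → ℂ)} (hW : ∀ x ∈ W, R.mulVec x ∈ W) {x : Fin n → ℂ} (hx : x ∈ W) :
    S.mulVec x ∈ W := by
  have hSR : S * R = 1 := mul_eq_one_comm.1 hRS
  let f : W →ₗ[ℂ] W := R.mulVecLin.restrict hW
  have hf : Function.Injective f := by
    intro y z h
    have h1 : R.mulVec y = R.mulVec z := congrArg Subtype.val h
    have h2 := congrArg S.mulVec h1
    rw [Matrix.mulVec_mulVec, Matrix.mulVec_mulVec, hSR, Matrix.one_mulVec, Matrix.one_mulVec] at h2
    exact Subtype.ext h2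
  obtain ⟨y, hy⟩ := LinearMap.surjective_of_injective hf ⟨x, hx⟩
  have h1 : R.mulVec y = x := congrArg Subtype.val hy
  rw [← h1, Matrix.mulVec_mulVec, hSR, Matrix.one_mulVec]
  exact y.2

theorem add_mul_inverse_eq (hR : (a • 1 - A) * R = 1) :
    (a • 1 + A) * R = (2 * a) • R - 1 := by
  have : a • 1 + A = (2 * a) • (1 : Matrix (Fin n) (Fin n) ℂ) - (a • 1 - A) := by
    rw [two_mul, add_smul]
    abel
  rw [this, Matrix.sub_mul, hR, Matrix.smul_mul, Matrix.one_mul]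

/-- Invariance under `(a + A) (a - A)⁻¹ = 2 a (a - A)⁻¹ - 1` passes to the resolvent, and from there
to `A`. -/
theorem mulVec_mem_of_bilinear (ha : a ≠ 0) (hR : (a • 1 - A) * R = 1)
    {W : Submodule ℂ (Fin n → ℂ)} (hW : ∀ x ∈ W, ((a • 1 + A) * R).mulVec x ∈ W) :
    (∀ x ∈ W, R.mulVec x ∈ W) ∧ ∀ x ∈ W, A.mulVec x ∈ W := by
  have h1 : ∀ x ∈ W, R.mulVec x ∈ W := by
    intro x hx
    have h := W.add_mem (hW x hx) hx
    rw [add_mul_inverse_eq hR, Matrix.sub_mulVec, Matrix.one_mulVec, sub_add_cancel,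
      Matrix.smul_mulVec] at h
    exact (W.smul_mem_iff (mul_ne_zero two_ne_zero ha)).1 h
  refine ⟨h1, fun x hx => ?_⟩
  have h2 := mulVec_mem_of_inverse_mulVec_mem (mul_eq_one_comm.1 hR) h1 hx
  rw [Matrix.sub_mulVec, Matrix.smul_mulVec, Matrix.one_mulVec] at h2
  have h3 := W.sub_mem (W.smul_mem a hx) h2
  rwa [sub_sub_cancel] at h3

theorem Controllable.bilinear (h : Controllable A B) (ha : a ≠ 0) (hR : (a • 1 - A) * R = 1) :
    Controllable ((a • 1 + A) * R) ((2 * a) • (R * B)) := by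
  intro W hB hA
  obtain ⟨hRW, hAW⟩ := mulVec_mem_of_bilinear ha hR hA
  refine h W (fun u => ?_) hAW
  have h1 := hB u
  rw [Matrix.smul_mulVec, W.smul_mem_iff (mul_ne_zero two_ne_zero ha), ← Matrix.mulVec_mulVec] at h1
  have h2 := mulVec_mem_of_inverse_mulVec_mem (mul_eq_one_comm.1 hR) hRW h1
  rwa [Matrix.mulVec_mulVec, hR, Matrix.one_mulVec] at h2

theorem Observable.bilinear (h : Observable A C) (ha : a ≠ 0) (hR : (a • 1 - A) * R = 1) :
    Observable ((a • 1 + A) * R) (C * R) := by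
  intro W hC hA
  obtain ⟨hRW, hAW⟩ := mulVec_mem_of_bilinear ha hR hA
  refine h W (fun x hx => ?_) hAW
  have h1 := hC _ (mulVec_mem_of_inverse_mulVec_mem (mul_eq_one_comm.1 hR) hRW hx)
  rwa [Matrix.mulVec_mulVec, Matrix.mul_assoc, mul_eq_one_comm.1 hR, Matrix.mul_one] at h1

/-- The resolvent of `A` at `s = a (1 - z) / (1 + z)` in terms of the discretized system. -/
theorem bilinear_resolvent {z : ℂ} (hz : 1 + z ≠ 0) (hR : (a • 1 - A) * R = 1)
    (hdet : IsUnit (1 - z • ((a • 1 + A) * R)).det) :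
    ((a * (1 - z) / (1 + z)) • 1 - A) * (R + z • (R * (1 - z • ((a • 1 + A) * R))⁻¹ *
      ((2 * a) • R))) = 1 := by
  set Q := (1 - z • ((a • 1 + A) * R))⁻¹ with hQ
  have h1 : Q * (1 - z • ((a • 1 + A) * R)) = 1 := Matrix.nonsing_inv_mul _ hdet
  have h2 : (1 - z • ((a • 1 + A) * R)) * Q = 1 := Matrix.mul_nonsing_inv _ hdet
  have h3 : 1 + z • (Q * ((2 * a) • R)) = (1 + z) • Q := by
    rw [add_mul_inverse_eq hR] at h1
    have h4 : Q * (1 - z • ((2 * a) • R - 1)) = (1 + z) • Q - z • (Q * ((2 * a) • R)) := by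
      simp only [Matrix.mul_sub, Matrix.mul_one, Matrix.mul_smul, add_smul, one_smul, smul_sub]
      abel
    rw [h4] at h1
    rw [← h1]
    abel
  have h5 : (1 + z) • (((a * (1 - z) / (1 + z)) • 1 - A) * R) = 1 - z • ((a • 1 + A) * R) := by
    calc _ = ((a * (1 - z)) • 1 - (1 + z) • A) * R := by
          rw [← Matrix.smul_mul, smul_sub, smul_smul, mul_div_cancel₀ _ hz]
      _ = ((a • 1 - A) - z • (a • 1 + A)) * R := by
          congr 1
          module
      _ = _ := by rw [Matrix.sub_mul, hR, Matrix.smul_mul]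
  calc _ = ((a * (1 - z) / (1 + z)) • 1 - A) * R * (1 + z • (Q * ((2 * a) • R))) := by
        simp only [Matrix.mul_add, Matrix.mul_one, Matrix.mul_smul, Matrix.mul_assoc]
    _ = 1 := by
        rw [h3, Matrix.mul_smul, ← Matrix.smul_mul, h5, h2]

theorem re_bilinear_pos {a : ℝ} (ha : 0 < a) {z : ℂ} (hz : z ∈ ball (0 : ℂ) 1) :
    1 + z ≠ 0 ∧ 0 < ((a : ℂ) * (1 - z) / (1 + z)).re := by
  rw [mem_ball_zero_iff] at hz
  have h1 : 1 + z ≠ 0 := by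
    intro h
    rw [eq_neg_of_add_eq_zero_right h, norm_neg, norm_one] at hz
    exact lt_irrefl _ hz
  refine ⟨h1, ?_⟩
  have hn : Complex.normSq z < 1 := by
    rw [Complex.normSq_eq_norm_sq]
    nlinarith [norm_nonneg z]
  have hpos : 0 < Complex.normSq (1 + z) := Complex.normSq_pos.2 h1
  have : ((a : ℂ) * (1 - z) / (1 + z)).re = a * (1 - Complex.normSq z) / Complex.normSq (1 + z) := by
    rw [Complex.div_re]
    simp [Complex.normSq_apply]
    field_simp
    ring
  rw [this]
  exact div_pos (mul_pos ha (by linarith)) hpos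

theorem exists_pos_not_eigenvalue (A : Matrix (Fin n) (Fin n) ℂ) :
    ∃ a : ℝ, 0 < a ∧ IsUnit ((a : ℂ) • 1 - A).det := by
  have hfin : {s : ℂ | A.charpoly.IsRoot s}.Finite :=
    Polynomial.finite_setOfPred_isRoot A.charpoly_monic.ne_zero
  have hfin' : ((fun a : ℝ => (a : ℂ)) ⁻¹' {s : ℂ | A.charpoly.IsRoot s}).Finite :=
    hfin.preimage Complex.ofReal_injective.injOn
  obtain ⟨a, ha, hroot⟩ := (Set.Ioi_infinite (0 : ℝ)).exists_notMem_finite hfin'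
  refine ⟨a, ha, isUnit_iff_ne_zero.2 fun h => hroot ?_⟩
  change A.charpoly.eval (a : ℂ) = 0
  rw [Matrix.eval_charpoly, ← h, Matrix.scalar_apply, Matrix.smul_one_eq_diagonal]

theorem differentiableAt_ratFunc_eval {f : RatFunc ℂ} {s : ℂ} (h : f.denom.eval s ≠ 0) :
    DifferentiableAt ℂ (fun s => f.eval (RingHom.id ℂ) s) s := by
  simp only [RatFunc.eval, Polynomial.eval₂_id]
  exact f.num.differentiableAt.div f.denom.differentiableAt h

/-- The bounded real lemma, in the direction from the transfer function to the storage function: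
discretize by `z ↦ a (1 - z) / (1 + z)` at a point `a > 0` that is not an eigenvalue. -/
theorem exists_continuous_storage {η : ℝ≥0∞} (hη : 1 < η) (hG : transferFunction A B C D ∈ HB m η)
    (hctrl : Controllable A B) (hobs : Observable A C) :
    ∃ H : Matrix (Fin n) (Fin n) ℂ, H.PosDef ∧ ∀ x u,
      2 * (star x ⬝ᵥ H.mulVec (A.mulVec x + B.mulVec u)).re
        + boundedRatio η * sqNorm (C.mulVec x + D.mulVec u) ≤ sqNorm u := by
  obtain ⟨a, ha, hdet⟩ := exists_pos_not_eigenvalue A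
  have ha0 : (a : ℂ) ≠ 0 := by exact_mod_cast ha.ne'
  set R := ((a : ℂ) • 1 - A)⁻¹ with hRdef
  have hR : ((a : ℂ) • 1 - A) * R = 1 := Matrix.mul_nonsing_inv _ hdet
  have hR' : R * ((a : ℂ) • 1 - A) = 1 := mul_eq_one_comm.1 hR
  set φ : ℂ → ℂ := fun z => (a : ℂ) * (1 - z) / (1 + z) with hφ
  have hc : 0 < boundedRatio η := one_pos.trans_le (one_le_boundedRatio hη)
  have hdiff : ∀ i j, DifferentiableOn ℂ
      (fun z => evalAt (transferFunction A B C D) (φ z) i j) (ball 0 1) := by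
    intro i j z hz
    obtain ⟨h1, h2⟩ := re_bilinear_pos ha hz
    have hd := differentiableAt_ratFunc_eval ((hG _ h2).1 i j)
    have hdφ : DifferentiableAt ℂ φ z := by
      refine DifferentiableAt.div ?_ ?_ h1 <;> fun_prop
    exact (DifferentiableAt.comp z hd hdφ).differentiableWithinAt
  have hnear : ∀ᶠ z in 𝓝 (0 : ℂ), evalAt (transferFunction A B C D) (φ z) = D + C * R * B +
      z • (C * R * (1 - z • (((a : ℂ) • 1 + A) * R))⁻¹ * ((2 * (a : ℂ)) • (R * B))) := by
    filter_upwards [eventually_isUnit_det_one_sub_smul (((a : ℂ) • 1 + A) * R),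
      ball_mem_nhds (0 : ℂ) one_pos] with z hz hball
    have hmul := bilinear_resolvent (re_bilinear_pos ha hball).1 hR hz
    have hsc : Matrix.scalar (Fin n) (φ z) = φ z • (1 : Matrix (Fin n) (Fin n) ℂ) := by
      rw [Matrix.scalar_apply, Matrix.smul_one_eq_diagonal]
    have hunit : IsUnit (Matrix.scalar (Fin n) (φ z) - A).det := by
      rw [hsc]
      exact Matrix.isUnit_det_of_right_inverse hmul
    have hval := transferFunction_hasValueAt A B C D hunit.ne_zero
    rw [hsc, Matrix.inv_eq_right_inv hmul] at hval
    rw [(matrixHasValueAt_iff.1 hval).2]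
    simp only [Matrix.mul_add, Matrix.add_mul, Matrix.mul_smul, Matrix.smul_mul, Matrix.mul_assoc]
    abel
  have hcontr : ∀ z ∈ ball (0 : ℂ) 1, ∀ u, boundedRatio η *
      sqNorm ((evalAt (transferFunction A B C D) (φ z)).mulVec u) ≤ sqNorm u := by
    intro z hz
    exact (posSemidef_one_sub_iff _ _).1 (hG _ (re_bilinear_pos ha hz).2).2
  obtain ⟨H, hH, hst⟩ := exists_discrete_storage hdiff hnear hc hcontr (hctrl.bilinear ha0 hR)
    (hobs.bilinear ha0 hR)
  refine ⟨(2 * a) • H, hH.smul (by positivity), fun x u => ?_⟩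
  -- With `p = A x + B u`, the input `u` takes the discrete state `a x - p` to `a x + p`.
  set p := A.mulVec x + B.mulVec u with hp
  have hx := hst ((a : ℂ) • x - p) u
  have hRp : R.mulVec ((a : ℂ) • x - p) = x - R.mulVec (B.mulVec u) := by
    have : (a : ℂ) • x - p = ((a : ℂ) • 1 - A).mulVec x - B.mulVec u := by
      rw [hp, Matrix.sub_mulVec, Matrix.smul_mulVec, Matrix.one_mulVec]
      abel
    rw [this, Matrix.mulVec_sub, Matrix.mulVec_mulVec, hR', Matrix.one_mulVec]
  have h1 : (((a : ℂ) • 1 + A) * R).mulVec ((a : ℂ) • x - p)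
      + ((2 * (a : ℂ)) • (R * B)).mulVec u = (a : ℂ) • x + p := by
    rw [add_mul_inverse_eq hR, Matrix.sub_mulVec, Matrix.smul_mulVec, hRp, Matrix.smul_mulVec,
      Matrix.one_mulVec, ← Matrix.mulVec_mulVec]
    module
  have h2 : (C * R).mulVec ((a : ℂ) • x - p) + (D + C * R * B).mulVec u =
      C.mulVec x + D.mulVec u := by
    rw [← Matrix.mulVec_mulVec, hRp, Matrix.add_mulVec, Matrix.mulVec_sub,
      ← Matrix.mulVec_mulVec, ← Matrix.mulVec_mulVec]
    abel
  rw [h1, h2] at hx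
  have hconj : (star p ⬝ᵥ H.mulVec x).re = (star x ⬝ᵥ H.mulVec p).re := by
    have : star p ⬝ᵥ H.mulVec x = star (star x ⬝ᵥ H.mulVec p) := by
      rw [Matrix.star_dotProduct, Matrix.star_mulVec, hH.1.eq, Matrix.dotProduct_mulVec]
    rw [this]
    simp
  have h3 : quadForm H ((a : ℂ) • x + p) - quadForm H ((a : ℂ) • x - p) =
      4 * a * (star x ⬝ᵥ H.mulVec p).re := by
    simp only [quadForm, Matrix.mulVec_add, Matrix.mulVec_sub, Matrix.mulVec_smul, star_add,
      star_sub, star_smul, add_dotProduct, sub_dotProduct, dotProduct_add, dotProduct_sub,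
      smul_dotProduct, dotProduct_smul, Complex.add_re, Complex.sub_re, smul_eq_mul,
      Complex.star_def, Complex.conj_ofReal, Complex.re_ofReal_mul, hconj]
    ring
  have h4 : (star x ⬝ᵥ ((2 * a) • H).mulVec p).re = 2 * a * (star x ⬝ᵥ H.mulVec p).re := by
    rw [Matrix.smul_mulVec, dotProduct_smul, Complex.real_smul, Complex.re_ofReal_mul]
  rw [h4]
  linarith

end

/-! ### The realization of the Cayley transform -/

section

open Metric Filter Topology

variable {n m : ℕ} {A : Matrix (Fin n) (Fin n) ℂ} {B : Matrix (Fin n) (Fin m) ℂ}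
  {C : Matrix (Fin m) (Fin n) ℂ} {D : Matrix (Fin m) (Fin m) ℂ}

theorem sqNorm_add_le (u v : Fin m → ℂ) : sqNorm (u + v) ≤ 2 * sqNorm u + 2 * sqNorm v := by
  simp only [sqNorm, Finset.mul_sum, ← Finset.sum_add_distrib]
  refine Finset.sum_le_sum fun i _ => ?_
  have h := norm_add_le (u i) (v i)
  have h0 := norm_nonneg (u i + v i)
  rw [Pi.add_apply]
  nlinarith [sq_nonneg (‖u i‖ - ‖v i‖)]

/-- If `(1 + F) (1 + G) = 2` with `G` bounded, then `1 + F` stays bounded below near infinity, so its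
value `1 + D` there is invertible. -/
theorem isUnit_one_add_of_mul_eq_two {η : ℝ≥0∞} (hη : 1 < η) {G : RatMatrix m} (hG : G ∈ HB m η)
    (h : (1 + transferFunction A B C D) * (1 + G) = 2) : IsUnit (1 + D) := by
  rw [← Matrix.mulVec_injective_iff_isUnit]
  refine (injective_iff_map_eq_zero (1 + D).mulVecLin).2 fun w hw => ?_
  rw [Matrix.mulVecLin_apply] at hw
  -- `2 w = (1 + G(s)) (F(s) - D) w`, and `F(s) - D` tends to `0` as `s = 1 / z` tends to infinity.
  set ρ : ℂ → Fin m → ℂ := fun z => z • C.mulVec ((1 - z • A)⁻¹.mulVec (B.mulVec w)) with hρ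
  have hlim : Tendsto (fun z => sqNorm (ρ z)) (𝓝 0) (𝓝 0) := by
    have hc : ContinuousAt (fun z : ℂ => ∑ i, ‖z * ∑ j, C i j *
        ∑ l, ((1 - z • A)⁻¹ : Matrix (Fin n) (Fin n) ℂ) j l * B.mulVec w l‖ ^ 2) 0 := by
      refine tendsto_finsetSum _ fun i _ => ?_
      have : ContinuousAt (fun z : ℂ => z * ∑ j, C i j *
        ∑ l, ((1 - z • A)⁻¹ : Matrix (Fin n) (Fin n) ℂ) j l * B.mulVec w l) 0 := by
        refine continuousAt_id.mul (tendsto_finsetSum _ fun j _ => ?_)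
        refine Tendsto.const_mul _ (tendsto_finsetSum _ fun l _ => ?_)
        exact (differentiableAt_inv_one_sub_smul A j l).continuousAt.tendsto.mul_const _
      exact this.norm.pow 2
    have h2 := hc.tendsto
    simp only [zero_mul, norm_zero, ne_eq, OfNat.ofNat_ne_zero, not_false_eq_true, zero_pow,
      Finset.sum_const_zero] at h2
    exact h2
  have hreal : Tendsto (fun t : ℝ => (t : ℂ)) (𝓝[>] 0) (𝓝 0) := by
    have : Tendsto (fun t : ℝ => (t : ℂ)) (𝓝 0) (𝓝 ((0 : ℝ) : ℂ)) :=
      Complex.continuous_ofReal.tendsto 0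
    simpa using this.mono_left nhdsWithin_le_nhds
  have hbound : ∀ᶠ t : ℝ in 𝓝[>] (0 : ℝ), sqNorm w ≤ sqNorm (ρ t) := by
    filter_upwards [hreal.eventually (eventually_isUnit_det_one_sub_smul A),
      self_mem_nhdsWithin] with t hdet ht
    have ht0 : (t : ℂ) ≠ 0 := by exact_mod_cast (ne_of_gt ht)
    have hinv : (Matrix.scalar (Fin n) (t : ℂ)⁻¹ - A) * ((t : ℂ) • (1 - (t : ℂ) • A)⁻¹) = 1 := by
      rw [Matrix.mul_smul, ← Matrix.smul_mul, smul_sub, Matrix.scalar_apply,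
        ← Matrix.smul_one_eq_diagonal, smul_smul, mul_inv_cancel₀ ht0, one_smul,
        Matrix.mul_nonsing_inv _ hdet]
    have hval := transferFunction_hasValueAt A B C D
      (Matrix.isUnit_det_of_right_inverse hinv).ne_zero
    rw [Matrix.inv_eq_right_inv hinv] at hval
    have hre : 0 < ((t : ℂ)⁻¹).re := by
      rw [← Complex.ofReal_inv, Complex.ofReal_re]
      exact inv_pos.2 ht
    obtain ⟨hpole, hpsd⟩ := hG _ hre
    have hone : MatrixHasValueAt (1 : RatMatrix m) (t : ℂ)⁻¹ 1 := by
      rw [← constMatrix_one]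
      exact matrixHasValueAt_constMatrix 1 _
    have hprod := (hone.add hval).mul (hone.add hpole.matrixHasValueAt)
    have htwo : MatrixHasValueAt (2 : RatMatrix m) (t : ℂ)⁻¹ 2 := by
      simpa only [one_add_one_eq_two] using hone.add hone
    rw [h] at hprod
    have h2 := hprod.unique htwo
    set V := evalAt G (t : ℂ)⁻¹
    set U := C * ((t : ℂ) • (1 - (t : ℂ) • A)⁻¹) * B + D
    have h3 : (1 + V) * (1 + U) = 2 := by
      have h4 : (((1 / 2 : ℂ) • (1 + U)) * (1 + V)) = 1 := by
        rw [Matrix.smul_mul, h2, ← one_add_one_eq_two (R := Matrix (Fin m) (Fin m) ℂ), smul_add,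
          ← add_smul]
        norm_num
      have h5 : (1 + V) * ((1 / 2 : ℂ) • (1 + U)) = 1 := mul_eq_one_comm.1 h4
      calc (1 + V) * (1 + U) = (2 : ℂ) • ((1 + V) * ((1 / 2 : ℂ) • (1 + U))) := by
            rw [Matrix.mul_smul, smul_smul]
            norm_num
        _ = 2 := by rw [h5, two_smul, one_add_one_eq_two]
    have hUw : (1 + U).mulVec w = ρ t := by
      have : 1 + U = (1 + D) + C * ((t : ℂ) • (1 - (t : ℂ) • A)⁻¹) * B := by
        simp only [U]
        abel
      rw [this, Matrix.add_mulVec, hw, zero_add, hρ]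
      simp [Matrix.mul_assoc, Matrix.smul_mulVec]
    have h6 : w + w = ρ t + V.mulVec (ρ t) := by
      have := congrArg (fun M => M.mulVec w) h3
      simp only [← Matrix.mulVec_mulVec, hUw] at this
      rw [Matrix.add_mulVec, Matrix.one_mulVec, ← one_add_one_eq_two, Matrix.add_mulVec,
        Matrix.one_mulVec] at this
      exact this.symm
    have h7 := sqNorm_add_le (ρ t) (V.mulVec (ρ t))
    rw [← h6] at h7
    have h8 : sqNorm (w + w) = 4 * sqNorm w := by
      simp only [sqNorm, Finset.mul_sum, Pi.add_apply, ← two_mul, norm_mul, mul_pow]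
      norm_num
    have h9 := (posSemidef_one_sub_iff _ _).1 hpsd (ρ t)
    have h10 : sqNorm (V.mulVec (ρ t)) ≤ boundedRatio η * sqNorm (V.mulVec (ρ t)) :=
      le_mul_of_one_le_left (sqNorm_nonneg _) (one_le_boundedRatio hη)
    linarith
  exact sqNorm_eq_zero (le_antisymm (ge_of_tendsto (hlim.comp hreal) hbound) (sqNorm_nonneg w))

theorem Controllable.cayley (h : Controllable A B) (hD : IsUnit (1 + D)) :
    Controllable (A - B * (1 + D)⁻¹ * C) (-(((√2 : ℝ) : ℂ) • (B * (1 + D)⁻¹))) := by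
  rw [Matrix.isUnit_iff_isUnit_det] at hD
  intro W hB hA
  have hs : ((√2 : ℝ) : ℂ) ≠ 0 := by simp
  have h1 : ∀ u, (B * (1 + D)⁻¹).mulVec u ∈ W := by
    intro u
    have := hB u
    rw [Matrix.neg_mulVec, Matrix.smul_mulVec, W.neg_mem_iff] at this
    exact (W.smul_mem_iff hs).1 this
  refine h W (fun u => ?_) (fun x hx => ?_)
  · have := h1 ((1 + D).mulVec u)
    rwa [Matrix.mulVec_mulVec, Matrix.nonsing_inv_mul_cancel_right _ _ hD] at this
  · have h2 := W.add_mem (hA x hx) (h1 (C.mulVec x))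
    rwa [Matrix.sub_mulVec, ← Matrix.mulVec_mulVec x, sub_add_cancel] at h2

theorem Observable.cayley (h : Observable A C) (hD : IsUnit (1 + D)) :
    Observable (A - B * (1 + D)⁻¹ * C) (((√2 : ℝ) : ℂ) • ((1 + D)⁻¹ * C)) := by
  rw [Matrix.isUnit_iff_isUnit_det] at hD
  intro W hC hA
  have hs : ((√2 : ℝ) : ℂ) ≠ 0 := by simp
  have h1 : ∀ x ∈ W, C.mulVec x = 0 := by
    intro x hx
    have := hC x hx
    rw [Matrix.smul_mulVec, smul_eq_zero, or_iff_right hs] at this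
    have h2 := congrArg (1 + D).mulVec this
    rwa [Matrix.mulVec_mulVec, Matrix.mul_nonsing_inv_cancel_left _ _ hD, Matrix.mulVec_zero] at h2
  refine h W h1 fun x hx => ?_
  have h2 := hA x hx
  rwa [Matrix.sub_mulVec, ← Matrix.mulVec_mulVec, h1 x hx, Matrix.mulVec_zero, sub_zero] at h2

/-- The bounded real lemma, in the direction from the storage function to the transfer function:
with `s x = A x + B u` the dissipation inequality becomes
`2 Re s ⟪x, H x⟫ + c ‖G(s) u‖² ≤ ‖u‖²`. -/
theorem transferFunction_mem_HB {η : ℝ≥0∞} (hη : 1 < η) {H : Matrix (Fin n) (Fin n) ℂ}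
    (hH : H.PosDef)
    (hdiss : ∀ x u, 2 * (star x ⬝ᵥ H.mulVec (A.mulVec x + B.mulVec u)).re
      + boundedRatio η * sqNorm (C.mulVec x + D.mulVec u) ≤ sqNorm u) :
    transferFunction A B C D ∈ HB m η := by
  intro s hs
  have hc : 0 < boundedRatio η := one_pos.trans_le (one_le_boundedRatio hη)
  have hscal : ∀ x : Fin n → ℂ, (star x ⬝ᵥ H.mulVec (s • x)).re = s.re * quadForm H x := by
    intro x
    rw [Matrix.mulVec_smul, dotProduct_smul, smul_eq_mul, Complex.mul_re, quadForm,
      ← (Complex.le_def.1 (hH.posSemidef.dotProduct_mulVec_nonneg x)).2]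
    simp
  have hdet : (Matrix.scalar (Fin n) s - A).det ≠ 0 := by
    intro h0
    obtain ⟨x, hx0, hx⟩ := Matrix.exists_mulVec_eq_zero_iff.2 h0
    have hAx : A.mulVec x = s • x := by
      rw [Matrix.sub_mulVec, sub_eq_zero, Matrix.scalar_apply, ← Matrix.smul_one_eq_diagonal,
        Matrix.smul_mulVec, Matrix.one_mulVec] at hx
      exact hx.symm
    have h1 := hdiss x 0
    have h2 : sqNorm (0 : Fin m → ℂ) = 0 := by simp [sqNorm]
    simp only [Matrix.mulVec_zero, add_zero, hAx, hscal, h2] at h1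
    have h3 : 0 < quadForm H x := (Complex.lt_def.1 (hH.dotProduct_mulVec_pos hx0)).1
    have h4 := mul_pos hs h3
    have h5 := mul_nonneg hc.le (sqNorm_nonneg (C.mulVec x))
    linarith
  have hval := transferFunction_hasValueAt A B C D hdet
  obtain ⟨hpole, heval⟩ := matrixHasValueAt_iff.1 hval
  refine ⟨hpole, ?_⟩
  rw [heval, posSemidef_one_sub_iff]
  intro u
  set S := (Matrix.scalar (Fin n) s - A)⁻¹ with hS
  set x := S.mulVec (B.mulVec u) with hx
  have hsx : A.mulVec x + B.mulVec u = s • x := by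
    have h1 : (Matrix.scalar (Fin n) s - A).mulVec x = B.mulVec u := by
      rw [hx, Matrix.mulVec_mulVec, hS, Matrix.mul_nonsing_inv _ (isUnit_iff_ne_zero.2 hdet),
        Matrix.one_mulVec]
    rw [← h1, Matrix.sub_mulVec, Matrix.scalar_apply, ← Matrix.smul_one_eq_diagonal,
      Matrix.smul_mulVec, Matrix.one_mulVec]
    abel
  have hy : (C * S * B + D).mulVec u = C.mulVec x + D.mulVec u := by
    rw [Matrix.add_mulVec, hx, Matrix.mulVec_mulVec, Matrix.mulVec_mulVec, Matrix.mul_assoc]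
  have h1 := hdiss x u
  rw [hsx, hscal] at h1
  have h2 : 0 ≤ quadForm H x :=
    (Complex.le_def.1 (hH.posSemidef.dotProduct_mulVec_nonneg x)).1
  rw [hy]
  linarith [mul_nonneg hs.le h2]

end

end HyperPositive

theorem mainTheorem1 (m n : ℕ) (η : ℝ≥0∞) (hη : 1 < η)
    (F : HyperPositive.RatMatrix m) (hF : HyperPositive.NoPoleAtInfinity F)
    (A : Matrix (Fin n) (Fin n) ℂ) (B : Matrix (Fin n) (Fin m) ℂ)
    (C : Matrix (Fin m) (Fin n) ℂ) (D : Matrix (Fin m) (Fin m) ℂ)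
    (hmin : HyperPositive.IsMinimalRealization F A B C D) :
    F ∈ HyperPositive.HP m η ↔
      IsUnit (1 + D) ∧
        ∃ H : Matrix (Fin n) (Fin n) ℂ, H.PosDef ∧
          ((HyperPositive.stackedCayley A B C D).conjTranspose *
            HyperPositive.weight m η H *
            HyperPositive.stackedCayley A B C D).PosSemidef := by
  open HyperPositive in
  have hlmi : ∀ H : Matrix (Fin n) (Fin n) ℂ, H.PosDef → _ := fun H hH =>
    posSemidef_weight_iff hη hH.isHermitian
      (A - B * (1 + D)⁻¹ * C) (-(((√2 : ℝ) : ℂ) • (B * (1 + D)⁻¹)))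
      (((√2 : ℝ) : ℂ) • ((1 + D)⁻¹ * C)) ((1 + D)⁻¹ * (1 - D))
  constructor
  · rintro ⟨G, hG, hunit, hFG⟩
    have hprod : (1 + F) * (1 + G) = 2 := hFG ▸ one_add_cayley_mul hunit
    rw [hmin.realizes] at hprod
    have hD : IsUnit (1 + D) := isUnit_one_add_of_mul_eq_two hη hG hprod
    refine ⟨hD, ?_⟩
    have hGT : G = transferFunction (A - B * (1 + D)⁻¹ * C)
        (-(((√2 : ℝ) : ℂ) • (B * (1 + D)⁻¹))) (((√2 : ℝ) : ℂ) • ((1 + D)⁻¹ * C))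
        ((1 + D)⁻¹ * (1 - D)) :=
      eq_of_one_add_mul_eq_two hprod (one_add_transferFunction_mul A B C D hD)
    obtain ⟨H, hH, hst⟩ := exists_continuous_storage hη (hGT ▸ hG) (hmin.controllable.cayley hD)
      (hmin.observable.cayley hD)
    exact ⟨H, hH, (hlmi H hH).2 hst⟩
  · rintro ⟨hD, H, hH, hpsd⟩
    obtain ⟨hunit, hFG⟩ := eq_cayley_of_mul_eq_two (one_add_transferFunction_mul A B C D hD)
    exact ⟨_, transferFunction_mem_HB hη hH ((hlmi H hH).1 hpsd), hunit,
      hmin.realizes.trans hFG⟩
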